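/- Let $g\in\{1,2,3,4,6\}$ and let $m_1,m_2\ge 1$ be integers, with $m_1=m_2$ if $g$ is odd. Put $n=1+\frac g2(m_1+m_2)$ and $m=\frac{2n}{g}$. (These are the relations satisfied by the number $g$ of distinct principal curvatures and their multiplicities $m_1,m_2$ for an isoparametric hypersurface of $\mathbb S^n$.) For $H\in\mathbb R$ consider the system $$\begin{aligned}\xi'&=\sin 2\vartheta\cos\alpha,\qquad \vartheta'=\sin 2\vartheta\sin\alpha,\\ \alpha'&=m\sin 2\vartheta\,\tanh\!\big(\tfrac2g\xi\big)\sin\alpha+2(m_1\cos^2\vartheta-m_2\sin^2\vartheta)\cos\alpha+\tfrac2g H\sin 2\vartheta\,\operatorname{sech}\!\big(\tfrac2g\xi\big).\end{aligned}$$ For $\delta\in(0,\frac\pi2)$ let $(\xi_\delta,\vartheta_\delta,\alpha_\delta)$ be its solution on $\mathbb R$ with $(\xi_\delta,\vartheta_\delta,\alpha_\delta)(0)=(0,\delta,0)$. Call $\delta$ *of type 1* if there is $T>0$ with $\xi_\delta(T)=0$ and $\vartheta_\delta'(t)\neq0$ for all $t\in(0,T)$, and *of type 2* if there is $T>0$ with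 $\vartheta_\delta'(T)=0$ and $\xi_\delta(t)\ne0$ for all $t\in(0,T)$. Let $$\delta^*=\sup\{\delta\in(0,\tfrac\pi2)\mid \delta_0\text{ is of type 1 for all }\delta_0\in(0,\delta)\},$$ with $\delta^*=0$ if the set is empty. **Proposition.** Let $H=0$. Then $\delta^*\in(0,\frac\pi2)$, and $\delta^*$ is both of type 1 and of type 2. Moreover, the solution $(\xi,\vartheta,\alpha)$ with initial value $(0,\delta^*,0)$ satisfies $\vartheta(t)\in(0,\frac\pi2)$ for all $t\in\mathbb R$; for every $t\in\mathbb R$, $\xi(t)=0$ if and only if $\vartheta'(t)=0$; and there is $T>0$ such that $\xi(T)=\vartheta'(T)=0$, both $\xi$ and $\vartheta'$ have no zero in $(0,T)$, and the profile curve $t\mapsto(\xi(t),\vartheta(t))$ is a smooth regular curve that is periodic with period $2T$ and injective on $[0,2T)$; that is, it is a periodic, simple closed curve. -/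

import Mathlib

open Real Set

/-- The profile curve system with parameters `g`, `n`, `m₁`, `m₂` and mean curvature `H`:
`ξ' = sin 2ϑ cos α`, `ϑ' = sin 2ϑ sin α`,
`α' = m sin 2ϑ tanh(2ξ/g) sin α + 2 (m₁ cos² ϑ - m₂ sin² ϑ) cos α + (2/g) H sin 2ϑ sech(2ξ/g)`,
where `m = 2n/g`.  The solutions considered are those defined for all times
(every solution extends to one, since the right-hand side is globally Lipschitz). -/
structure IsCMCSolution (g n m₁ m₂ : ℕ) (H : ℝ) (ξ ϑ α : ℝ → ℝ) : Prop where
  hasDerivAt_xi : ∀ t, HasDerivAt ξ (sin (2 * ϑ t) * cos (α t)) t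
  hasDerivAt_theta : ∀ t, HasDerivAt ϑ (sin (2 * ϑ t) * sin (α t)) t
  hasDerivAt_alpha : ∀ t, HasDerivAt α
    ((2 * n / g : ℝ) * sin (2 * ϑ t) * tanh (2 / g * ξ t) * sin (α t)
      + 2 * (m₁ * cos (ϑ t) ^ 2 - m₂ * sin (ϑ t) ^ 2) * cos (α t)
      + 2 / g * H * sin (2 * ϑ t) * (cosh (2 / g * ξ t))⁻¹) t

/-- `(ξ, ϑ, α)` is the solution with initial height `δ`, that is, the one with
`(ξ, ϑ, α)(0) = (0, δ, 0)`.  (It exists and is unique, the right-hand side being globally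
Lipschitz, so "there is" and "for every" such solution mean the same.) -/
structure IsShot (g n m₁ m₂ : ℕ) (H δ : ℝ) (ξ ϑ α : ℝ → ℝ) : Prop where
  isCMCSolution : IsCMCSolution g n m₁ m₂ H ξ ϑ α
  xi_zero : ξ 0 = 0
  theta_zero : ϑ 0 = δ
  alpha_zero : α 0 = 0

/-- `δ ∈ (0, π/2)` is of type 1: there is `T > 0` with `ξ(T) = 0` and `ϑ' ≠ 0` on `(0, T)`. -/
def IsType1 (g n m₁ m₂ : ℕ) (H δ : ℝ) : Prop :=
  δ ∈ Ioo 0 (π / 2) ∧ ∃ ξ ϑ α : ℝ → ℝ, IsShot g n m₁ m₂ H δ ξ ϑ α ∧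
    ∃ T > 0, ξ T = 0 ∧ ∀ t ∈ Ioo 0 T, deriv ϑ t ≠ 0

/-- `δ ∈ (0, π/2)` is of type 2: there is `T > 0` with `ϑ'(T) = 0` and `ξ ≠ 0` on `(0, T)`. -/
def IsType2 (g n m₁ m₂ : ℕ) (H δ : ℝ) : Prop :=
  δ ∈ Ioo 0 (π / 2) ∧ ∃ ξ ϑ α : ℝ → ℝ, IsShot g n m₁ m₂ H δ ξ ϑ α ∧
    ∃ T > 0, deriv ϑ T = 0 ∧ ∀ t ∈ Ioo 0 T, ξ t ≠ 0

/-- The critical initial height `δ* = sup {δ ∈ (0, π/2) | every δ₀ ∈ (0, δ) is of type 1}`,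
which is `0` if the set is empty (this is the convention of `sSup` on `ℝ`; the set is
bounded above by `π/2`). -/
noncomputable def criticalHeight (g n m₁ m₂ : ℕ) (H : ℝ) : ℝ :=
  sSup {δ | δ ∈ Ioo 0 (π / 2) ∧ ∀ δ₀ ∈ Ioo 0 δ, IsType1 g n m₁ m₂ H δ₀}

/-- A smooth regular curve `c` in the plane that is periodic with period `L > 0` and
runs through a simple closed curve once in each period. -/
structure IsSmoothSimpleClosedCurve (c : ℝ → ℝ × ℝ) (L : ℝ) : Prop where
  contDiff : ContDiff ℝ (⊤ : ℕ∞) c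
  regular : ∀ t, deriv c t ≠ 0
  period_pos : 0 < L
  periodic : Function.Periodic c L
  injOn : InjOn c (Ico 0 L)

/-!
# The critical profile curve for `H = 0` is closed and simple

Write `a = 2/g`, `M = 2n/g`, `Q(ϑ) = 2 (m₁ cos² ϑ - m₂ sin² ϑ)` and `w(ϑ) = sin^m₁ ϑ cos^m₂ ϑ`, and
let `c ∈ (0, π/2)` be the zero of `Q`. The argument uses only `M, a > 0` and `m₁, m₂ ≥ 1`. Its main
tool is the momentum `P = w(ϑ) cos α`, which satisfies `P' = -M w sin 2ϑ tanh(aξ) sin² α` and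
therefore does not increase while `ξ ≥ 0`.

A solution starting at `(0, δ, 0)` with `δ < c` enters the region `ξ > 0`, `0 < α < π`. It stays
there until a first event, at which `ξ = 0` or `α ∈ {0, π}`; if there is no event, `ϑ` increases to
`π/2` and `ξ` does not decrease (`IsProfileShot.tendsto_theta_of_forever`). The critical height
`δ*` lies in `(0, c)`:

* For small `δ` the solution is of type 1 (`eventually_returnsFirst`). It stays close to the axis
  `ξ = 0`, where `R = P / ξ` satisfies the Riccati inequality `R' ≤ -2 R²`. As `(log tan ϑ)' ≤ 2`, it
  takes a long time to leave the boundary `ϑ = 0`, so that `R` is small afterwards. It then becomes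
  negative and blows up, that is, `ξ` vanishes, before `ϑ` comes close to `π/2`.
* For some `δ < c` close to `c` it is not (`IsShotFamily.exists_not_returnsFirst`). The solution
  follows the stationary solution `ϑ = c` far away from the axis and turns back only at a height
  where `Q` is negative, so that `α` reaches `π` before `ξ` is back at `0`
  (`IsProfile.xi_drop_le`).

At `δ*` there is an event (`IsShotFamily.not_forever`), since solutions close to one that runs into
the boundary `ϑ = π/2` do not return to the axis. The events `ξ > 0`, `α ∈ {0, π}` and `ξ = 0`,
`0 < α < π` are transversal, as a degenerate one would put the solution on a stationary solution or
on the axis; hence they persist under perturbation of `δ` and cannot occur at `δ*`. The only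
possibility left is `ξ = 0` and `α = π` at the same time `T` (`IsShotFamily.exists_simultaneous`).
The reflection symmetries at the times `0` and `T` then make the curve periodic with period `2T`; it
rises in `ξ ≥ 0` on `[0, T]` and returns along the mirror image, hence it is simple.
-/

section Profile

open Filter Topology

/-! ### The minimal profile system -/

/-- The balance function `Q(ϑ) = 2 (m₁ cos² ϑ - m₂ sin² ϑ)`, the coefficient of `cos α` in `α'`. -/
noncomputable def bal (m₁ m₂ : ℕ) (x : ℝ) : ℝ := 2 * (m₁ * cos x ^ 2 - m₂ * sin x ^ 2)

/-- A solution, defined for all times, of the profile system with `H = 0`, where `a = 2/g` and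
`M = 2n/g` are allowed to be arbitrary real numbers. -/
structure IsProfile (M a : ℝ) (m₁ m₂ : ℕ) (ξ ϑ α : ℝ → ℝ) : Prop where
  xi : ∀ t, HasDerivAt ξ (sin (2 * ϑ t) * cos (α t)) t
  theta : ∀ t, HasDerivAt ϑ (sin (2 * ϑ t) * sin (α t)) t
  alpha : ∀ t, HasDerivAt α
    (M * sin (2 * ϑ t) * tanh (a * ξ t) * sin (α t) + bal m₁ m₂ (ϑ t) * cos (α t)) t

/-- The right-hand side of the profile system as a vector field on `ℝ³`. -/
noncomputable def profileField (M a : ℝ) (m₁ m₂ : ℕ) (p : ℝ × ℝ × ℝ) : ℝ × ℝ × ℝ :=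
  (sin (2 * p.2.1) * cos p.2.2, sin (2 * p.2.1) * sin p.2.2,
    M * sin (2 * p.2.1) * tanh (a * p.1) * sin p.2.2 + bal m₁ m₂ p.2.1 * cos p.2.2)

variable {M a : ℝ} {m₁ m₂ : ℕ}

lemma IsProfile.hasDerivAt {ξ ϑ α : ℝ → ℝ} (h : IsProfile M a m₁ m₂ ξ ϑ α) (t : ℝ) :
    HasDerivAt (fun t => (ξ t, ϑ t, α t)) (profileField M a m₁ m₂ (ξ t, ϑ t, α t)) t :=
  (h.xi t).prodMk ((h.theta t).prodMk (h.alpha t))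

lemma isProfile_of_hasDerivAt {γ : ℝ → ℝ × ℝ × ℝ}
    (h : ∀ t, HasDerivAt γ (profileField M a m₁ m₂ (γ t)) t) :
    IsProfile M a m₁ m₂ (fun t => (γ t).1) (fun t => (γ t).2.1) (fun t => (γ t).2.2) where
  xi t := (hasFDerivAt_fst (𝕜 := ℝ) (E := ℝ) (F := ℝ × ℝ)).comp_hasDerivAt t (h t)
  theta t := ((hasFDerivAt_fst (𝕜 := ℝ) (E := ℝ) (F := ℝ)).comp_hasDerivAt _
    ((hasFDerivAt_snd (𝕜 := ℝ) (E := ℝ) (F := ℝ × ℝ)).comp_hasDerivAt t (h t)))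
  alpha t := ((hasFDerivAt_snd (𝕜 := ℝ) (E := ℝ) (F := ℝ)).comp_hasDerivAt _
    ((hasFDerivAt_snd (𝕜 := ℝ) (E := ℝ) (F := ℝ × ℝ)).comp_hasDerivAt t (h t)))

/-! ### Global existence, uniqueness and continuous dependence -/

/-- A real function that is bounded and Lipschitz, both with the constant `C`. -/
def BddLip {E : Type*} [PseudoMetricSpace E] (f : E → ℝ) : Prop :=
  ∃ C, (∀ x, |f x| ≤ C) ∧ ∀ x y, |f x - f y| ≤ C * dist x y

section BddLip

variable {E : Type*} [PseudoMetricSpace E] {f f' : E → ℝ}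

lemma BddLip.mul (hf : BddLip f) (hg : BddLip f') : BddLip (fun x => f x * f' x) := by
  obtain ⟨C, hC, hC'⟩ := hf
  obtain ⟨D, hD, hD'⟩ := hg
  refine ⟨max (C * D) (C * D + C * D), fun x => ?_, fun x y => ?_⟩
  · rw [abs_mul]
    exact (mul_le_mul (hC x) (hD x) (abs_nonneg _) ((abs_nonneg _).trans (hC x))).trans
      (le_max_left _ _)
  · calc |f x * f' x - f y * f' y| = |f x * (f' x - f' y) + f' y * (f x - f y)| := by ring_nf
      _ ≤ |f x| * |f' x - f' y| + |f' y| * |f x - f y| := by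
        rw [← abs_mul, ← abs_mul]; exact abs_add_le _ _
      _ ≤ C * (D * dist x y) + D * (C * dist x y) := by
        gcongr
        · exact (abs_nonneg _).trans (hC x)
        · exact hC x
        · exact hD' x y
        · exact (abs_nonneg _).trans (hD x)
        · exact hD y
        · exact hC' x y
      _ = (C * D + C * D) * dist x y := by ring
      _ ≤ _ := by gcongr; exact le_max_right _ _

lemma BddLip.add (hf : BddLip f) (hg : BddLip f') : BddLip (fun x => f x + f' x) := by
  obtain ⟨C, hC, hC'⟩ := hf
  obtain ⟨D, hD, hD'⟩ := hg
  refine ⟨C + D, fun x => (abs_add_le _ _).trans (add_le_add (hC x) (hD x)), fun x y => ?_⟩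
  rw [add_sub_add_comm, add_mul]
  exact (abs_add_le _ _).trans (add_le_add (hC' x y) (hD' x y))

lemma bddLip_const (r : ℝ) : BddLip (fun _ : E => r) :=
  ⟨|r|, fun _ => le_rfl, fun x y => by simpa using! mul_nonneg (abs_nonneg r) dist_nonneg⟩

lemma BddLip.comp_of_lip {φ : ℝ → ℝ} (hφ : BddLip φ) {K : ℝ}
    (hf : ∀ x y, |f x - f y| ≤ K * dist x y) : BddLip (fun x => φ (f x)) := by
  obtain ⟨C, hC, hC'⟩ := hφ
  have hC0 : 0 ≤ C := (abs_nonneg _).trans (hC 0)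
  refine ⟨max C (C * K), fun x => (hC _).trans (le_max_left _ _), fun x y => ?_⟩
  calc |φ (f x) - φ (f y)| ≤ C * dist (f x) (f y) := hC' _ _
    _ ≤ C * (K * dist x y) := by gcongr; exact hf x y
    _ = C * K * dist x y := by ring
    _ ≤ _ := by gcongr; exact le_max_right _ _

end BddLip

lemma bddLip_sin : BddLip sin :=
  ⟨1, abs_sin_le_one, fun x y => by
    simpa [Real.dist_eq] using! Real.lipschitzWith_sin.dist_le_mul x y⟩

lemma bddLip_cos : BddLip cos :=
  ⟨1, abs_cos_le_one, fun x y => by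
    simpa [Real.dist_eq] using! Real.lipschitzWith_cos.dist_le_mul x y⟩

lemma hasDerivAt_tanh_real (x : ℝ) : HasDerivAt tanh (1 - tanh x ^ 2) x := by
  have h := (Real.hasDerivAt_sinh x).div (Real.hasDerivAt_cosh x) (Real.cosh_pos x).ne'
  have hc := (Real.cosh_pos x).ne'
  have he : tanh = fun y => sinh y / cosh y := funext Real.tanh_eq_sinh_div_cosh
  rw [he]
  convert! h using 1
  field_simp

lemma bddLip_tanh : BddLip tanh := by
  refine ⟨1, fun x => (abs_tanh_lt_one x).le, fun x y => ?_⟩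
  have h : LipschitzWith 1 tanh := by
    refine lipschitzWith_of_nnnorm_deriv_le (fun x => (hasDerivAt_tanh_real x).differentiableAt)
      fun x => ?_
    rw [(hasDerivAt_tanh_real x).deriv, ← NNReal.coe_le_coe, coe_nnnorm, NNReal.coe_one,
      Real.norm_eq_abs, abs_le]
    have := tanh_sq_lt_one x
    constructor <;> nlinarith [sq_nonneg (tanh x)]
  simpa [Real.dist_eq] using! h.dist_le_mul x y

lemma profileField_bounds (M a : ℝ) (m₁ m₂ : ℕ) : ∃ C : NNReal,
    (∀ p, ‖profileField M a m₁ m₂ p‖ ≤ C) ∧ LipschitzWith C (profileField M a m₁ m₂) := by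
  have l1 : ∀ b : ℝ, ∀ x y : ℝ × ℝ × ℝ, |b * x.1 - b * y.1| ≤ |b| * dist x y := fun b x y => by
    rw [← mul_sub, abs_mul]
    gcongr
    rw [← Real.dist_eq, Prod.dist_eq]; exact le_max_left _ _
  have l2' : ∀ x y : ℝ × ℝ × ℝ, |x.2.1 - y.2.1| ≤ 1 * dist x y := fun x y => by
    rw [← Real.dist_eq, Prod.dist_eq, Prod.dist_eq, one_mul]
    exact (le_max_left _ _).trans (le_max_right _ _)
  have l2 : ∀ b : ℝ, ∀ x y : ℝ × ℝ × ℝ, |b * x.2.1 - b * y.2.1| ≤ |b| * dist x y := fun b x y => by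
    rw [← mul_sub, abs_mul]
    gcongr
    simpa using l2' x y
  have l3 : ∀ x y : ℝ × ℝ × ℝ, |x.2.2 - y.2.2| ≤ 1 * dist x y := fun x y => by
    rw [← Real.dist_eq, Prod.dist_eq, Prod.dist_eq, one_mul]
    exact (le_max_right _ _).trans (le_max_right _ _)
  have b1 : BddLip fun p : ℝ × ℝ × ℝ => sin (2 * p.2.1) := bddLip_sin.comp_of_lip (l2 2)
  have b2 : BddLip fun p : ℝ × ℝ × ℝ => tanh (a * p.1) := bddLip_tanh.comp_of_lip (l1 a)
  have b3 : BddLip fun p : ℝ × ℝ × ℝ => sin p.2.2 := bddLip_sin.comp_of_lip l3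
  have b4 : BddLip fun p : ℝ × ℝ × ℝ => cos p.2.2 := bddLip_cos.comp_of_lip l3
  have b5 : BddLip fun p : ℝ × ℝ × ℝ => sin p.2.1 := bddLip_sin.comp_of_lip l2'
  have b6 : BddLip fun p : ℝ × ℝ × ℝ => cos p.2.1 := bddLip_cos.comp_of_lip l2'
  have b7 : BddLip fun p : ℝ × ℝ × ℝ => bal m₁ m₂ p.2.1 := by
    have := ((bddLip_const (2 * (m₁ : ℝ))).mul (b6.mul b6)).add
      ((bddLip_const (-(2 * (m₂ : ℝ)))).mul (b5.mul b5))
    convert! this using 2 with p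
    simp only [bal]; ring
  obtain ⟨C₁, h₁, h₁'⟩ := b1.mul b4
  obtain ⟨C₂, h₂, h₂'⟩ := b1.mul b3
  obtain ⟨C₃, h₃, h₃'⟩ := ((((bddLip_const M).mul b1).mul b2).mul b3).add (b7.mul b4)
  let C := max C₁ (max C₂ C₃)
  have hC0 : 0 ≤ C := ((abs_nonneg _).trans (h₁ 0)).trans (le_max_left _ _)
  have e₁ : C₁ ≤ C := le_max_left _ _
  have e₂ : C₂ ≤ C := (le_max_left _ _).trans (le_max_right _ _)
  have e₃ : C₃ ≤ C := (le_max_right _ _).trans (le_max_right _ _)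
  refine ⟨⟨C, hC0⟩, fun p => ?_, LipschitzWith.of_dist_le_mul fun p q => ?_⟩
  · exact max_le ((h₁ p).trans e₁) (max_le ((h₂ p).trans e₂) ((h₃ p).trans e₃))
  · have hd : 0 ≤ dist p q := dist_nonneg
    exact max_le ((h₁' p q).trans (mul_le_mul_of_nonneg_right e₁ hd))
      (max_le ((h₂' p q).trans (mul_le_mul_of_nonneg_right e₂ hd))
        ((h₃' p q).trans (mul_le_mul_of_nonneg_right e₃ hd)))

/-- A bounded and globally Lipschitz vector field has a global integral curve through every
point: the Picard–Lindelöf solutions on the intervals `[-(n + 1), n + 1]` fit together. -/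
theorem exists_global_integral_curve {E : Type*} [NormedAddCommGroup E] [NormedSpace ℝ E]
    [CompleteSpace E] {v : E → E} {C : NNReal} (hb : ∀ x, ‖v x‖ ≤ C) (hl : LipschitzWith C v)
    (x₀ : E) : ∃ γ : ℝ → E, γ 0 = x₀ ∧ ∀ t, HasDerivAt γ (v (γ t)) t := by
  have key : ∀ n : ℕ, ∃ γ : ℝ → E, γ 0 = x₀ ∧
      ∀ t ∈ Ioo (-(n + 1 : ℝ)) (n + 1), HasDerivAt γ (v (γ t)) t := by
    intro n
    have hn : (0 : ℝ) < n + 1 := by positivity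
    have hpl : IsPicardLindelof (fun _ => v) (tmin := -(n + 1 : ℝ)) (tmax := n + 1)
        ⟨0, by constructor <;> linarith⟩ x₀ (C * (n + 1)) 0 C C := by
      refine IsPicardLindelof.of_time_independent (fun x _ => hb x) hl.lipschitzOnWith ?_
      simp
    obtain ⟨γ, h0, h⟩ := hpl.exists_eq_forall_mem_Icc_hasDerivWithinAt₀
    exact ⟨γ, h0, fun t ht => (h t (Ioo_subset_Icc_self ht)).hasDerivAt (Icc_mem_nhds ht.1 ht.2)⟩
  choose γ h0 h using key
  have agree : ∀ m n : ℕ, m ≤ n → EqOn (γ m) (γ n) (Ioo (-(m + 1 : ℝ)) (m + 1)) := by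
    intro m n hmn
    have hmn' : (m : ℝ) ≤ n := by exact_mod_cast hmn
    have hm : (0 : ℝ) < m + 1 := by positivity
    refine ODE_solution_unique_of_mem_Ioo (v := fun _ => v) (s := fun _ => univ) (K := C) (t₀ := 0)
      (fun t _ => hl.lipschitzOnWith) ⟨by linarith, hm⟩ (fun t ht => ⟨h m t ht, mem_univ _⟩)
      (fun t ht => ⟨h n t ⟨by linarith [ht.1], by linarith [ht.2]⟩, mem_univ _⟩) ?_
    rw [h0, h0]
  refine ⟨fun t => γ ⌈|t|⌉₊ t, by simpa using h0 _, fun t => ?_⟩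
  set n := ⌈|t|⌉₊ + 1 with hn
  have hev : (fun t => γ ⌈|t|⌉₊ t) =ᶠ[𝓝 t] γ n := by
    have : ∀ᶠ u in 𝓝 t, |u| < |t| + 1 :=
      (continuous_abs.tendsto t).eventually_lt_const (by linarith)
    filter_upwards [this] with u hu
    apply agree
    · rw [hn]
      refine Nat.ceil_le.2 ?_
      push_cast
      linarith [Nat.le_ceil |t|]
    · have := abs_lt.1 (lt_of_le_of_lt (Nat.le_ceil |u|) (lt_add_one (⌈|u|⌉₊ : ℝ)))
      exact this
  have ht : t ∈ Ioo (-(n + 1 : ℝ)) (n + 1) := by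
    refine abs_lt.1 ?_
    rw [hn]; push_cast
    linarith [Nat.le_ceil |t|]
  have := (h n t ht).congr_of_eventuallyEq hev
  rwa [← hev.eq_of_nhds] at this

/-- A solution is determined by its value at one time. -/
theorem IsProfile.unique {ξ ϑ α ξ' ϑ' α' : ℝ → ℝ} (h : IsProfile M a m₁ m₂ ξ ϑ α)
    (h' : IsProfile M a m₁ m₂ ξ' ϑ' α') {T : ℝ} (hξ : ξ T = ξ' T) (hϑ : ϑ T = ϑ' T)
    (hα : α T = α' T) : ξ = ξ' ∧ ϑ = ϑ' ∧ α = α' := by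
  obtain ⟨C, -, hl⟩ := profileField_bounds M a m₁ m₂
  have := ODE_solution_unique_univ (v := fun _ => profileField M a m₁ m₂) (s := fun _ => univ)
    (K := C) (t₀ := T) (fun _ => hl.lipschitzOnWith) (fun t => ⟨h.hasDerivAt t, mem_univ _⟩)
    (fun t => ⟨h'.hasDerivAt t, mem_univ _⟩) (by simp [hξ, hϑ, hα])
  have e : ∀ t, ξ t = ξ' t ∧ ϑ t = ϑ' t ∧ α t = α' t := fun t => by simpa using congrFun this t
  exact ⟨funext fun t => (e t).1, funext fun t => (e t).2.1, funext fun t => (e t).2.2⟩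

/-- The solutions starting horizontally on the axis `ξ = 0`, as functions of the initial height
and of time: `(Ξ δ, Θ δ, A δ)` is the solution with `(ξ, ϑ, α)(0) = (0, δ, 0)`. -/
structure IsShotFamily (M a : ℝ) (m₁ m₂ : ℕ) (Ξ Θ A : ℝ → ℝ → ℝ) : Prop where
  profile : ∀ δ, IsProfile M a m₁ m₂ (Ξ δ) (Θ δ) (A δ)
  xi_zero : ∀ δ, Ξ δ 0 = 0
  theta_zero : ∀ δ, Θ δ 0 = δ
  alpha_zero : ∀ δ, A δ 0 = 0
  continuousOn : ContinuousOn (fun p : ℝ × ℝ => (Ξ p.1 p.2, Θ p.1 p.2, A p.1 p.2))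
    (univ ×ˢ Ici 0)

theorem exists_isShotFamily (M a : ℝ) (m₁ m₂ : ℕ) :
    ∃ Ξ Θ A : ℝ → ℝ → ℝ, IsShotFamily M a m₁ m₂ Ξ Θ A := by
  obtain ⟨C, hb, hl⟩ := profileField_bounds M a m₁ m₂
  choose γ h0 h using fun δ : ℝ => exists_global_integral_curve hb hl ((0, δ, 0) : ℝ × ℝ × ℝ)
  refine ⟨fun δ t => (γ δ t).1, fun δ t => (γ δ t).2.1, fun δ t => (γ δ t).2.2,
    fun δ => isProfile_of_hasDerivAt (h δ), fun δ => by simp [h0], fun δ => by simp [h0],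
    fun δ => by simp [h0], ?_⟩
  change ContinuousOn (fun p : ℝ × ℝ => γ p.1 p.2) _
  have hdist : ∀ δ δ' t, 0 ≤ t → dist (γ δ t) (γ δ' t) ≤ dist δ δ' * exp (C * t) := by
    intro δ δ' t ht
    have := dist_le_of_trajectories_ODE (v := fun _ => profileField M a m₁ m₂) (K := C)
      (f := γ δ) (g := γ δ') (a := 0) (b := t) (δ := dist δ δ') (fun _ => hl)
      (fun u _ => (h δ u).continuousAt.continuousWithinAt) (fun u _ => (h δ u).hasDerivWithinAt)
      (fun u _ => (h δ' u).continuousAt.continuousWithinAt) (fun u _ => (h δ' u).hasDerivWithinAt)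
      (by simp [h0, Prod.dist_eq]) t ⟨ht, le_rfl⟩
    simpa using this
  rintro ⟨δ, t⟩ -
  rw [ContinuousWithinAt, tendsto_iff_dist_tendsto_zero]
  have hle : ∀ p ∈ (univ ×ˢ Ici 0 : Set (ℝ × ℝ)), dist (γ p.1 p.2) (γ δ t) ≤
      dist p.1 δ * exp (C * p.2) + dist (γ δ p.2) (γ δ t) := fun p hp =>
    (dist_triangle _ (γ δ p.2) _).trans (by gcongr; exact hdist _ _ _ hp.2)
  refine squeeze_zero' (Eventually.of_forall fun _ => dist_nonneg)
    (eventually_mem_nhdsWithin.mono hle) ?_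
  have hc : Continuous (γ δ) := continuous_iff_continuousAt.2 fun u => (h δ u).continuousAt
  have : Continuous fun p : ℝ × ℝ => dist p.1 δ * exp (C * p.2) + dist (γ δ p.2) (γ δ t) := by
    fun_prop
  simpa using this.continuousAt.tendsto.mono_left (nhdsWithin_le_nhds (a := (δ, t)))

/-- Solutions are smooth, by bootstrapping the differential equation. -/
theorem IsProfile.contDiff {ξ ϑ α : ℝ → ℝ} (h : IsProfile M a m₁ m₂ ξ ϑ α) :
    ContDiff ℝ (⊤ : ℕ∞) (fun t => (ξ t, ϑ t, α t)) := by
  have hv : ∀ n : ℕ, ContDiff ℝ n (profileField M a m₁ m₂) := by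
    intro n
    have ht : ContDiff ℝ n tanh := by
      have he : tanh = fun y => sinh y / cosh y := funext Real.tanh_eq_sinh_div_cosh
      rw [he]
      exact Real.contDiff_sinh.div Real.contDiff_cosh fun x => (Real.cosh_pos x).ne'
    have ht' : ContDiff ℝ n fun p : ℝ × ℝ × ℝ => tanh (a * p.1) :=
      ht.comp (contDiff_const.mul contDiff_fst)
    unfold profileField bal
    fun_prop
  refine contDiff_infty.2 fun n => ?_
  induction n with
  | zero =>
    exact contDiff_zero.2 (continuous_iff_continuousAt.2 fun t => (h.hasDerivAt t).continuousAt)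
  | succ n ih =>
    push_cast
    refine contDiff_succ_iff_deriv.2 ⟨fun t => (h.hasDerivAt t).differentiableAt, by simp, ?_⟩
    rw [funext fun t => (h.hasDerivAt t).deriv]
    exact (hv n).comp ih

variable {ξ ϑ α : ℝ → ℝ}

/-! ### Elementary tools -/

lemma le_of_hasDerivAt_nonneg {f f' : ℝ → ℝ} {u v : ℝ} (huv : u ≤ v)
    (h : ∀ t ∈ Icc u v, HasDerivAt f (f' t) t) (h0 : ∀ t ∈ Ioo u v, 0 ≤ f' t) : f u ≤ f v := by
  refine monotoneOn_of_deriv_nonneg (convex_Icc u v)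
    (fun t ht => (h t ht).continuousAt.continuousWithinAt) (fun t ht => ?_) (fun t ht => ?_)
    (left_mem_Icc.2 huv) (right_mem_Icc.2 huv) huv
  · exact (h t (interior_subset ht)).differentiableAt.differentiableWithinAt
  · rw [interior_Icc] at ht
    rw [(h t (Ioo_subset_Icc_self ht)).deriv]
    exact h0 t ht

lemma lt_of_hasDerivAt_pos {f f' : ℝ → ℝ} {u v : ℝ} (huv : u < v)
    (h : ∀ t ∈ Icc u v, HasDerivAt f (f' t) t) (h0 : ∀ t ∈ Ioo u v, 0 < f' t) : f u < f v := by
  refine strictMonoOn_of_deriv_pos (convex_Icc u v)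
    (fun t ht => (h t ht).continuousAt.continuousWithinAt) (fun t ht => ?_)
    (left_mem_Icc.2 huv.le) (right_mem_Icc.2 huv.le) huv
  rw [interior_Icc] at ht
  rw [(h t (Ioo_subset_Icc_self ht)).deriv]
  exact h0 t ht

lemma ge_of_hasDerivAt_nonpos {f f' : ℝ → ℝ} {u v : ℝ} (huv : u ≤ v)
    (h : ∀ t ∈ Icc u v, HasDerivAt f (f' t) t) (h0 : ∀ t ∈ Ioo u v, f' t ≤ 0) : f v ≤ f u := by
  have := le_of_hasDerivAt_nonneg (f := fun t => -f t) huv (fun t ht => (h t ht).neg)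
    (fun t ht => by simpa using h0 t ht)
  simpa using this

/-- A function whose derivative tends to a positive limit is unbounded above. -/
lemma not_bddAbove_of_tendsto_deriv {f f' : ℝ → ℝ} {L B u : ℝ} (h : ∀ t, HasDerivAt f (f' t) t)
    (hL : Tendsto f' atTop (𝓝 L)) (hL0 : 0 < L) (hB : ∀ t, u < t → f t ≤ B) : False := by
  obtain ⟨t₀, ht₀⟩ := eventually_atTop.1 (hL.eventually_const_lt (half_lt_self hL0))
  set t₁ := max t₀ (u + 1)
  set t₂ := t₁ + (|B - f t₁| + 1) / (L / 2)
  have h12 : t₁ < t₂ := by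
    have : 0 < (|B - f t₁| + 1) / (L / 2) := by positivity
    simp only [t₂]; linarith
  have := le_of_hasDerivAt_nonneg (f := fun t => f t - L / 2 * t) h12.le
    (fun t _ => (h t).sub ((hasDerivAt_id t).const_mul (L / 2)))
    (fun t ht => by
      have := ht₀ t ((le_max_left _ _).trans ht.1.le)
      linarith)
  have h2 := hB t₂ (by have := le_max_right t₀ (u + 1); linarith)
  have h3 : L / 2 * t₂ = L / 2 * t₁ + (|B - f t₁| + 1) := by
    simp only [t₂]; field_simp
  have := le_abs_self (B - f t₁)
  linarith

/-- If `f` is positive on `(u, v)` and vanishes at `v`, its derivative at `v` is nonpositive. -/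
lemma hasDerivAt_nonpos_of_pos_left {f : ℝ → ℝ} {f' u v : ℝ} (huv : u < v)
    (h : HasDerivAt f f' v) (hv : f v = 0) (hpos : ∀ t ∈ Ioo u v, 0 < f t) : f' ≤ 0 := by
  by_contra! hf'
  have h1 : ∀ᶠ t in 𝓝[<] v, f t < 0 := by
    have := h.tendsto_slope.eventually_const_lt hf'
    have h2 : ∀ᶠ t in 𝓝[<] v, 0 < slope f v t := this.filter_mono
      (nhdsWithin_mono v fun t (ht : t < v) => ht.ne)
    filter_upwards [h2, self_mem_nhdsWithin] with t ht (htv : t < v)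
    rw [slope_def_field, hv, sub_zero] at ht
    by_contra! hc
    have := div_nonpos_of_nonneg_of_nonpos hc (sub_neg.2 htv).le
    linarith
  obtain ⟨t, ht, ht'⟩ := (h1.and (Ioo_mem_nhdsLT huv)).exists
  exact absurd (hpos t ht') (not_lt.2 ht.le)

/-- If `f v = 0` and `f' v > 0`, then `f` is positive just after `v`. -/
lemma eventually_pos_right {f : ℝ → ℝ} {f' v : ℝ} (h : HasDerivAt f f' v) (hv : f v = 0)
    (hf' : 0 < f') : ∀ᶠ t in 𝓝[>] v, 0 < f t := by
  have h2 : ∀ᶠ t in 𝓝[>] v, 0 < slope f v t := (h.tendsto_slope.eventually_const_lt hf').filter_mono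
    (nhdsWithin_mono v fun t (ht : v < t) => ht.ne')
  filter_upwards [h2, self_mem_nhdsWithin] with t ht (htv : v < t)
  rw [slope_def_field, hv, sub_zero] at ht
  by_contra! hc
  have := div_nonpos_of_nonpos_of_nonneg hc (sub_pos.2 htv).le
  linarith

/-! ### The strip, the balance function and the weight -/

lemma sin_two_mul_pos {x : ℝ} (hx : x ∈ Ioo 0 (π / 2)) : 0 < sin (2 * x) :=
  sin_pos_of_pos_of_lt_pi (by linarith [hx.1]) (by linarith [hx.2])

lemma sin_pos_of_mem {x : ℝ} (hx : x ∈ Ioo 0 (π / 2)) : 0 < sin x :=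
  sin_pos_of_pos_of_lt_pi hx.1 (by linarith [hx.2, pi_pos])

lemma cos_pos_of_mem {x : ℝ} (hx : x ∈ Ioo 0 (π / 2)) : 0 < cos x :=
  cos_pos_of_mem_Ioo ⟨by linarith [hx.1, pi_pos], hx.2⟩

lemma IsProfile.continuous_xi (h : IsProfile M a m₁ m₂ ξ ϑ α) : Continuous ξ :=
  continuous_iff_continuousAt.2 fun t => (h.xi t).continuousAt

lemma IsProfile.continuous_theta (h : IsProfile M a m₁ m₂ ξ ϑ α) : Continuous ϑ :=
  continuous_iff_continuousAt.2 fun t => (h.theta t).continuousAt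

lemma IsProfile.continuous_alpha (h : IsProfile M a m₁ m₂ ξ ϑ α) : Continuous α :=
  continuous_iff_continuousAt.2 fun t => (h.alpha t).continuousAt

/-- Solutions stay in the strip: `ϑ = 0` and `ϑ = π/2` solve the equation
`ϑ' = sin 2ϑ sin α` for any given function `α`. -/
theorem IsProfile.theta_mem (h : IsProfile M a m₁ m₂ ξ ϑ α) (h0 : ϑ 0 ∈ Ioo 0 (π / 2)) (t : ℝ) :
    ϑ t ∈ Ioo 0 (π / 2) := by
  have hne : ∀ b : ℝ, sin (2 * b) = 0 → ϑ 0 ≠ b → ∀ u, ϑ u ≠ b := by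
    intro b hb h0b u hu
    have hl : ∀ t, LipschitzOnWith 2 (fun y => sin (2 * y) * sin (α t)) univ := by
      intro t
      refine (LipschitzWith.of_dist_le_mul fun x y => ?_).lipschitzOnWith
      rw [Real.dist_eq, Real.dist_eq, ← sub_mul, abs_mul]
      have h1 := Real.lipschitzWith_sin.dist_le_mul (2 * x) (2 * y)
      rw [Real.dist_eq, Real.dist_eq, ← mul_sub, abs_mul] at h1
      have h2 := abs_sin_le_one (α t)
      calc _ ≤ |sin (2 * x) - sin (2 * y)| * 1 := by gcongr
        _ ≤ _ := by simpa using h1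
    have := ODE_solution_unique_univ (v := fun t y => sin (2 * y) * sin (α t)) (t₀ := u)
      (f := ϑ) (g := fun _ => b) hl (fun t => ⟨h.theta t, mem_univ _⟩)
      (fun t => ⟨by simpa [hb] using hasDerivAt_const t b, mem_univ _⟩) hu
    exact h0b (congrFun this 0)
  have hz := hne 0 (by simp) h0.1.ne'
  have hp := hne (π / 2) (by rw [mul_div_cancel₀ _ two_ne_zero, sin_pi]) h0.2.ne
  have hconn : ∀ b, (∀ u, ϑ u ≠ b) → (b < ϑ 0 ↔ b < ϑ t) := by
    intro b hb
    have hc := isPreconnected_univ.image ϑ h.continuous_theta.continuousOn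
    constructor <;> intro hlt <;> by_contra! hge
    · obtain ⟨u, -, hu⟩ := hc.Icc_subset ⟨t, mem_univ _, rfl⟩ ⟨0, mem_univ _, rfl⟩ ⟨hge, hlt.le⟩
      exact hb u hu
    · obtain ⟨u, -, hu⟩ := hc.Icc_subset ⟨0, mem_univ _, rfl⟩ ⟨t, mem_univ _, rfl⟩ ⟨hge, hlt.le⟩
      exact hb u hu
  refine ⟨(hconn 0 hz).1 h0.1, lt_of_le_of_ne ?_ (hp t)⟩
  by_contra! hlt
  exact absurd ((hconn _ hp).2 hlt) (not_lt.2 h0.2.le)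

lemma bal_eq (m₁ m₂ : ℕ) (x : ℝ) : bal m₁ m₂ x = (m₁ - m₂ : ℝ) + (m₁ + m₂) * cos (2 * x) := by
  rw [bal, cos_two_mul, sin_sq]; ring

lemma continuous_bal : Continuous (bal m₁ m₂) := by unfold bal; fun_prop

lemma bal_strictAntiOn (hm₁ : 0 < m₁) : StrictAntiOn (bal m₁ m₂) (Icc 0 (π / 2)) := by
  intro x hx y hy hxy
  rw [bal_eq, bal_eq]
  have hc : cos (2 * y) < cos (2 * x) :=
    strictAntiOn_cos ⟨by linarith [hx.1], by linarith [hx.2]⟩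
      ⟨by linarith [hy.1], by linarith [hy.2]⟩ (by linarith)
  have : (0 : ℝ) < m₁ := by exact_mod_cast hm₁
  have : (0 : ℝ) ≤ m₂ := Nat.cast_nonneg _
  nlinarith

/-- The height of the stationary solutions: the zero of the balance function. -/
lemma exists_bal_eq_zero (hm₁ : 0 < m₁) (hm₂ : 0 < m₂) :
    ∃ c ∈ Ioo 0 (π / 2), bal m₁ m₂ c = 0 := by
  have h1 : (0 : ℝ) < m₁ := by exact_mod_cast hm₁
  have h2 : (0 : ℝ) < m₂ := by exact_mod_cast hm₂
  refine intermediate_value_Ioo' (by positivity) continuous_bal.continuousOn ⟨?_, ?_⟩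
  · simp [bal, h2]
  · simp [bal, h1]

/-- The weight `w(ϑ) = sin^m₁ ϑ cos^m₂ ϑ`, which solves `w' sin ϑ cos ϑ = (Q/2) w`. -/
noncomputable def wt (m₁ m₂ : ℕ) (x : ℝ) : ℝ := sin x ^ m₁ * cos x ^ m₂

lemma continuous_wt : Continuous (wt m₁ m₂) := by unfold wt; fun_prop

lemma wt_pos {x : ℝ} (hx : x ∈ Ioo 0 (π / 2)) : 0 < wt m₁ m₂ x :=
  mul_pos (pow_pos (sin_pos_of_mem hx) _) (pow_pos (cos_pos_of_mem hx) _)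

/-- Since `m₁, m₂ ≥ 1`, the weight is at most `sin ϑ cos ϑ`. -/
lemma wt_le (hm₁ : 0 < m₁) (hm₂ : 0 < m₂) {x : ℝ} (hx : x ∈ Ioo 0 (π / 2)) :
    2 * wt m₁ m₂ x ≤ sin (2 * x) := by
  have hs := sin_pos_of_mem hx
  have hc := cos_pos_of_mem hx
  rw [sin_two_mul, mul_assoc, wt]
  gcongr
  · exact pow_le_of_le_one hs.le (sin_le_one x) hm₁.ne'
  · exact pow_le_of_le_one hc.le (cos_le_one x) hm₂.ne'

lemma wt_le_one (hm₁ : 0 < m₁) (hm₂ : 0 < m₂) {x : ℝ} (hx : x ∈ Ioo 0 (π / 2)) :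
    wt m₁ m₂ x ≤ 1 := by
  linarith [wt_le hm₁ hm₂ hx, sin_le_one (2 * x), wt_pos (m₁ := m₁) (m₂ := m₂) hx]

lemma wt_pi_div_two (hm₂ : 0 < m₂) : wt m₁ m₂ (π / 2) = 0 := by
  simp [wt, hm₂.ne']

lemma IsProfile.hasDerivAt_wt (h : IsProfile M a m₁ m₂ ξ ϑ α) (t : ℝ) :
    HasDerivAt (fun t => wt m₁ m₂ (ϑ t)) (wt m₁ m₂ (ϑ t) * bal m₁ m₂ (ϑ t) * sin (α t)) t := by
  have h1 := ((h.theta t).sin.pow m₁).mul ((h.theta t).cos.pow m₂)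
  have e : ∀ (m : ℕ) (x : ℝ), (m : ℝ) * x ^ (m - 1) * x = m * x ^ m := by
    rintro (_ | m) x
    · simp
    · simp [pow_succ, mul_assoc]
  convert! h1 using 1
  have e1 := e m₁ (sin (ϑ t))
  have e2 := e m₂ (cos (ϑ t))
  simp only [wt, bal, sin_two_mul, Pi.pow_apply]
  linear_combination (-2 * cos (ϑ t) ^ 2 * sin (α t) * cos (ϑ t) ^ m₂) * e1
    + (2 * sin (ϑ t) ^ 2 * sin (α t) * sin (ϑ t) ^ m₁) * e2

/-- The momentum identity `(w cos α)' = -M w sin 2ϑ tanh(aξ) sin² α`: the quantity `w cos α` would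
be conserved without the term of `α'` that depends on `ξ`. -/
theorem IsProfile.hasDerivAt_momentum (h : IsProfile M a m₁ m₂ ξ ϑ α) (t : ℝ) :
    HasDerivAt (fun t => wt m₁ m₂ (ϑ t) * cos (α t))
      (-(M * wt m₁ m₂ (ϑ t) * sin (2 * ϑ t) * tanh (a * ξ t) * sin (α t) ^ 2)) t := by
  convert! (h.hasDerivAt_wt t).mul (h.alpha t).cos using 1
  ring

lemma tanh_nonneg_of_nonneg {x : ℝ} (hx : 0 ≤ x) : 0 ≤ tanh x := by
  rw [Real.tanh_eq_sinh_div_cosh]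
  exact div_nonneg (Real.sinh_nonneg_iff.2 hx) (Real.cosh_pos x).le

lemma tanh_le_self {x : ℝ} (hx : 0 ≤ x) : tanh x ≤ x := by
  have := le_of_hasDerivAt_nonneg (f := fun y => y - tanh y) hx
    (fun t _ => (hasDerivAt_id t).sub (hasDerivAt_tanh_real t))
    (fun t _ => by simpa using sq_nonneg (tanh t))
  simp at this
  linarith

lemma half_le_tanh {x : ℝ} (hx : 0 ≤ x) (hx' : x ≤ 1 / 2) : x / 2 ≤ tanh x := by
  have := le_of_hasDerivAt_nonneg (f := fun y => tanh y - y / 2) hx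
    (fun t _ => (hasDerivAt_tanh_real t).sub ((hasDerivAt_id t).div_const 2))
    (fun t ht => by
      have h1 := tanh_le_self ht.1.le
      have h2 := tanh_nonneg_of_nonneg ht.1.le
      have h3 := ht.2
      nlinarith)
  simp at this
  linarith

/-- While `ξ ≥ 0`, the momentum `w cos α` does not increase. -/
theorem IsProfile.momentum_le (h : IsProfile M a m₁ m₂ ξ ϑ α) (hM : 0 ≤ M) (ha : 0 ≤ a)
    (h0 : ϑ 0 ∈ Ioo 0 (π / 2)) {u v : ℝ} (huv : u ≤ v) (hξ : ∀ t ∈ Ioo u v, 0 ≤ ξ t) :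
    wt m₁ m₂ (ϑ v) * cos (α v) ≤ wt m₁ m₂ (ϑ u) * cos (α u) := by
  refine ge_of_hasDerivAt_nonpos huv (fun t _ => h.hasDerivAt_momentum t) fun t ht => ?_
  have h1 := (wt_pos (m₁ := m₁) (m₂ := m₂) (h.theta_mem h0 t)).le
  have h2 := (sin_two_mul_pos (h.theta_mem h0 t)).le
  have h3 := tanh_nonneg_of_nonneg (mul_nonneg ha (hξ t ht))
  rw [neg_nonpos]
  positivity

/-- The momentum `w cos α` decreases at most at the rate `M B` with respect to `ϑ`, where `B`
bounds `tanh(aξ)`. -/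
theorem IsProfile.le_momentum (h : IsProfile M a m₁ m₂ ξ ϑ α) (hM : 0 ≤ M)
    (hm₁ : 0 < m₁) (hm₂ : 0 < m₂)
    (h0 : ϑ 0 ∈ Ioo 0 (π / 2)) {u v B : ℝ} (huv : u ≤ v) (hB : 0 ≤ B)
    (hξ : ∀ t ∈ Ioo u v, tanh (a * ξ t) ≤ B) (hα : ∀ t ∈ Ioo u v, 0 ≤ sin (α t)) :
    wt m₁ m₂ (ϑ u) * cos (α u) - M * B * (ϑ v - ϑ u) ≤ wt m₁ m₂ (ϑ v) * cos (α v) := by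
  have := le_of_hasDerivAt_nonneg
    (f := fun t => wt m₁ m₂ (ϑ t) * cos (α t) + M * B * ϑ t) huv
    (fun t _ => (h.hasDerivAt_momentum t).add ((h.theta t).const_mul (M * B))) fun t ht => by
      have h1 := (wt_pos (m₁ := m₁) (m₂ := m₂) (h.theta_mem h0 t)).le
      have h1' := wt_le_one hm₁ hm₂ (h.theta_mem h0 t)
      have h2 := (sin_two_mul_pos (h.theta_mem h0 t)).le
      have h3 := hξ t ht
      have h4 := hα t ht
      have h5 := sin_le_one (α t)
      have h6 : wt m₁ m₂ (ϑ t) * sin (α t) * tanh (a * ξ t) ≤ 1 * 1 * B :=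
        (mul_le_mul_of_nonneg_left h3 (mul_nonneg h1 h4)).trans (by gcongr)
      have h7 : 0 ≤ M * (sin (2 * ϑ t) * sin (α t)) *
        (B - wt m₁ m₂ (ϑ t) * sin (α t) * tanh (a * ξ t)) :=
        mul_nonneg (mul_nonneg hM (mul_nonneg h2 h4)) (by linarith)
      linarith
  linarith

variable {δ : ℝ}

/-! ### Symmetries and stationary solutions -/

/-- The reflection `ξ ↦ -ξ` of the profile plane maps solutions to solutions. -/
lemma IsProfile.reflect (h : IsProfile M a m₁ m₂ ξ ϑ α) :
    IsProfile M a m₁ m₂ (fun t => -ξ t) ϑ (fun t => π - α t) where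
  xi t := by
    have := (h.xi t).neg
    rwa [← mul_neg, ← cos_pi_sub] at this
  theta t := by simpa [sin_pi_sub] using h.theta t
  alpha t := by
    convert! (h.alpha t).const_sub π using 1
    rw [sin_pi_sub, cos_pi_sub, mul_neg, Real.tanh_neg]; ring

/-- The reflection `ξ ↦ -ξ` combined with the time reversal `t ↦ b - t`. -/
lemma IsProfile.reverse (h : IsProfile M a m₁ m₂ ξ ϑ α) (b : ℝ) {κ : ℝ}
    (hs : ∀ x, sin (κ - x) = -sin x) (hc : ∀ x, cos (κ - x) = cos x) :
    IsProfile M a m₁ m₂ (fun t => -ξ (b - t)) (fun t => ϑ (b - t)) (fun t => κ - α (b - t)) where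
  xi t := by
    have := ((h.xi (b - t)).comp_const_sub b t).neg
    rw [neg_neg, ← hc] at this
    exact this
  theta t := by
    convert! (h.theta (b - t)).comp_const_sub b t using 1
    rw [hs]; ring
  alpha t := by
    convert! ((h.alpha (b - t)).comp_const_sub b t).const_sub κ using 1
    rw [hs, hc, mul_neg a, Real.tanh_neg]; ring

/-- A solution that meets the axis `ξ = 0` with `α = π/2` is invariant under the reflection, hence
runs in the axis and has `α ≡ π/2`. -/
lemma IsProfile.alpha_eq_of_axis (h : IsProfile M a m₁ m₂ ξ ϑ α) {T : ℝ} (hξ : ξ T = 0)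
    (hα : α T = π / 2) (t : ℝ) : α t = π / 2 := by
  obtain ⟨-, -, h3⟩ := h.reflect.unique h (T := T) (by simp [hξ]) rfl (by rw [hα]; ring)
  have := congrFun h3 t
  linarith

/-- A solution that is horizontal at the balanced height `c` stays at this height. -/
lemma IsProfile.eq_stationary (h : IsProfile M a m₁ m₂ ξ ϑ α) {T c : ℝ} (hc : bal m₁ m₂ c = 0)
    (hϑ : ϑ T = c) (hα : sin (α T) = 0) :
    ξ = (fun t => ξ T + sin (2 * c) * cos (α T) * (t - T)) ∧ ϑ = (fun _ => c) ∧
      α = fun _ => α T := by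
  refine h.unique (T := T) ⟨fun t => ?_, fun t => ?_, fun t => ?_⟩ (by simp) hϑ rfl
  · simpa using (((hasDerivAt_id t).sub_const T).const_mul (sin (2 * c) * cos (α T))).const_add (ξ T)
  · simpa [hα] using hasDerivAt_const t c
  · simpa [hα, hc] using hasDerivAt_const t (α T)

/-! ### The first event of a solution starting on the axis -/

/-- The solution of the profile system with `H = 0` and `(ξ, ϑ, α)(0) = (0, δ, 0)`. -/
structure IsProfileShot (M a : ℝ) (m₁ m₂ : ℕ) (δ : ℝ) (ξ ϑ α : ℝ → ℝ) : Prop where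
  profile : IsProfile M a m₁ m₂ ξ ϑ α
  xi_zero : ξ 0 = 0
  theta_zero : ϑ 0 = δ
  alpha_zero : α 0 = 0

lemma IsShotFamily.shot {Ξ Θ A : ℝ → ℝ → ℝ} (h : IsShotFamily M a m₁ m₂ Ξ Θ A) (δ : ℝ) :
    IsProfileShot M a m₁ m₂ δ (Ξ δ) (Θ δ) (A δ) :=
  ⟨h.profile δ, h.xi_zero δ, h.theta_zero δ, h.alpha_zero δ⟩

lemma IsProfileShot.theta_mem (h : IsProfileShot M a m₁ m₂ δ ξ ϑ α) (hδ : δ ∈ Ioo 0 (π / 2))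
    (t : ℝ) : ϑ t ∈ Ioo 0 (π / 2) :=
  h.profile.theta_mem (by rwa [h.theta_zero]) t

lemma IsProfileShot.eventually_xi_pos (h : IsProfileShot M a m₁ m₂ δ ξ ϑ α)
    (hδ : δ ∈ Ioo 0 (π / 2)) : ∀ᶠ t in 𝓝[>] 0, 0 < ξ t :=
  eventually_pos_right (h.profile.xi 0) h.xi_zero
    (by simpa [h.theta_zero, h.alpha_zero] using sin_two_mul_pos hδ)

lemma IsProfileShot.eventually_alpha_pos (h : IsProfileShot M a m₁ m₂ δ ξ ϑ α)
    (hQ : 0 < bal m₁ m₂ δ) : ∀ᶠ t in 𝓝[>] 0, 0 < α t :=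
  eventually_pos_right (h.profile.alpha 0) h.alpha_zero
    (by simpa [h.theta_zero, h.alpha_zero] using hQ)

/-- Either `ξ > 0` and `0 < α < π` for all positive times, or there is a first time at which the
solution returns to the axis or is horizontal. -/
theorem IsProfileShot.forever_or_first_event (h : IsProfileShot M a m₁ m₂ δ ξ ϑ α)
    (hδ : δ ∈ Ioo 0 (π / 2)) (hQ : 0 < bal m₁ m₂ δ) :
    (∀ t > 0, 0 < ξ t ∧ α t ∈ Ioo 0 π) ∨
    ∃ T > 0, (∀ t ∈ Ioo 0 T, 0 < ξ t ∧ α t ∈ Ioo 0 π) ∧ 0 ≤ ξ T ∧ α T ∈ Icc 0 π ∧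
      (ξ T = 0 ∨ α T = 0 ∨ α T = π) := by
  by_cases hf : ∀ t > 0, 0 < ξ t ∧ α t ∈ Ioo 0 π
  · exact Or.inl hf
  right
  have cξ := h.profile.continuous_xi
  have cα := h.profile.continuous_alpha
  have hnear : ∀ᶠ t in 𝓝[>] (0 : ℝ), 0 < ξ t ∧ α t ∈ Ioo 0 π := by
    have h3 : ∀ᶠ t in 𝓝[>] (0 : ℝ), α t < π := by
      refine (cα.tendsto 0).eventually_lt_const ?_ |>.filter_mono nhdsWithin_le_nhds
      rw [h.alpha_zero]; exact pi_pos
    filter_upwards [h.eventually_xi_pos hδ, h.eventually_alpha_pos hQ, h3] with t h1 h2 h3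
    exact ⟨h1, h2, h3⟩
  obtain ⟨τ, hτ, hgood⟩ := (mem_nhdsGT_iff_exists_Ioo_subset).1 hnear
  set Z := {t | 0 < t ∧ ¬ (0 < ξ t ∧ α t ∈ Ioo 0 π)} with hZ
  have hZne : Z.Nonempty := by
    push Not at hf
    obtain ⟨t, ht, ht'⟩ := hf
    exact ⟨t, ht, fun hh => ht' hh.1 hh.2⟩
  have hlow : ∀ t ∈ Z, τ ≤ t := by
    intro t ht
    by_contra! hlt
    exact ht.2 (hgood ⟨ht.1, hlt⟩)
  have hbdd : BddBelow Z := ⟨τ, hlow⟩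
  set T := sInf Z with hT
  have hτT : τ ≤ T := le_csInf hZne hlow
  have hT0 : 0 < T := lt_of_lt_of_le hτ hτT
  have hbefore : ∀ t ∈ Ioo 0 T, 0 < ξ t ∧ α t ∈ Ioo 0 π := by
    intro t ht
    by_contra hn
    exact absurd (csInf_le hbdd (show t ∈ Z from ⟨ht.1, hn⟩)) (not_le.2 ht.2)
  have hev : ∀ᶠ t in 𝓝[<] T, t ∈ Ioo 0 T := Ioo_mem_nhdsLT hT0
  have hξT : 0 ≤ ξ T := ge_of_tendsto ((cξ.tendsto T).mono_left nhdsWithin_le_nhds)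
    (hev.mono fun t ht => (hbefore t ht).1.le)
  have hα0 : 0 ≤ α T := ge_of_tendsto ((cα.tendsto T).mono_left nhdsWithin_le_nhds)
    (hev.mono fun t ht => (hbefore t ht).2.1.le)
  have hαπ : α T ≤ π := le_of_tendsto ((cα.tendsto T).mono_left nhdsWithin_le_nhds)
    (hev.mono fun t ht => (hbefore t ht).2.2.le)
  refine ⟨T, hT0, hbefore, hξT, ⟨hα0, hαπ⟩, ?_⟩
  by_contra! hn
  have hopen : ∀ᶠ t in 𝓝 T, 0 < ξ t ∧ α t ∈ Ioo 0 π := by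
    filter_upwards [(cξ.tendsto T).eventually_const_lt (lt_of_le_of_ne hξT hn.1.symm),
      (cα.tendsto T).eventually_const_lt (lt_of_le_of_ne hα0 hn.2.1.symm),
      (cα.tendsto T).eventually_lt_const (lt_of_le_of_ne hαπ hn.2.2)] with t h1 h2 h3
    exact ⟨h1, h2, h3⟩
  obtain ⟨ε, hε, hball⟩ := Metric.eventually_nhds_iff.1 hopen
  obtain ⟨t, htZ, ht⟩ := exists_lt_of_csInf_lt hZne (show sInf Z < T + ε by linarith)
  have : T ≤ t := csInf_le hbdd htZ
  exact htZ.2 (hball (by rw [Real.dist_eq, abs_lt]; constructor <;> linarith))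

/-! ### Solutions without an event -/

lemma exists_tendsto_of_monotone_Ici {f : ℝ → ℝ} {B : ℝ}
    (hf : ∀ u v, 0 ≤ u → u ≤ v → f u ≤ f v) (hB : ∀ t, 0 ≤ t → f t ≤ B) :
    ∃ L, Tendsto f atTop (𝓝 L) ∧ ∀ t, 0 ≤ t → f t ≤ L := by
  have hmono : Monotone fun t => f (max t 0) := fun u v huv =>
    hf _ _ (le_max_right _ _) (max_le_max_right 0 huv)
  have hb : BddAbove (range fun t => f (max t 0)) :=
    ⟨B, by rintro _ ⟨t, rfl⟩; exact hB _ (le_max_right _ _)⟩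
  have hev : (fun t => f (max t 0)) =ᶠ[atTop] f := by
    filter_upwards [eventually_ge_atTop (0 : ℝ)] with t ht
    rw [max_eq_left ht]
  exact ⟨_, (tendsto_atTop_ciSup hmono hb).congr' hev, fun t ht => by
    simpa [max_eq_left ht] using le_ciSup hb t⟩

/-- If there is no event, `ϑ` increases to `π/2`. Otherwise `ϑ` converges in the interior of the
strip, so the monotone momentum `w cos α` makes `α` converge too; each possible limit of `α`
contradicts the system. -/
theorem IsProfileShot.tendsto_theta_of_forever (h : IsProfileShot M a m₁ m₂ δ ξ ϑ α)
    (hM : 0 < M) (ha : 0 < a) (hm₁ : 0 < m₁) (hm₂ : 0 < m₂) (hδ : δ ∈ Ioo 0 (π / 2))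
    (hf : ∀ t > 0, 0 < ξ t ∧ α t ∈ Ioo 0 π) : Tendsto ϑ atTop (𝓝 (π / 2)) := by
  have hϑ := h.theta_mem hδ
  have hs : ∀ t, 0 < sin (2 * ϑ t) := fun t => sin_two_mul_pos (hϑ t)
  have hsin : ∀ t > 0, 0 < sin (α t) := fun t ht =>
    sin_pos_of_pos_of_lt_pi (hf t ht).2.1 (hf t ht).2.2
  have hmono : ∀ u v, 0 ≤ u → u < v → ϑ u < ϑ v := fun u v hu huv =>
    lt_of_hasDerivAt_pos huv (fun t _ => h.profile.theta t) fun t ht =>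
      mul_pos (hs t) (hsin t (hu.trans_lt ht.1))
  obtain ⟨L, hL, hle⟩ := exists_tendsto_of_monotone_Ici (f := ϑ) (B := π / 2)
    (fun u v hu huv => huv.eq_or_lt.elim (fun e => e ▸ le_rfl) fun hlt => (hmono u v hu hlt).le)
    (fun t _ => (hϑ t).2.le)
  have hlt : ∀ t, 0 ≤ t → ϑ t < L := fun t ht =>
    (hmono t (t + 1) ht (by linarith)).trans_le (hle _ (by linarith))
  have hL2 : L ≤ π / 2 := le_of_tendsto hL (Eventually.of_forall fun t => (hϑ t).2.le)
  rcases hL2.eq_or_lt with rfl | hL2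
  · exact hL
  exfalso
  have hLmem : L ∈ Ioo 0 (π / 2) := ⟨(hϑ 0).1.trans (hlt 0 le_rfl), hL2⟩
  have hsL := sin_two_mul_pos hLmem
  have hwL := wt_pos (m₁ := m₁) (m₂ := m₂) hLmem
  obtain ⟨p, hp, -⟩ := exists_tendsto_of_monotone_Ici
    (f := fun t => -(wt m₁ m₂ (ϑ t) * cos (α t))) (B := 1)
    (fun u v hu huv => neg_le_neg (h.profile.momentum_le hM.le ha.le (hϑ 0) huv
      fun t ht => (hf t (hu.trans_lt ht.1)).1.le))
    (fun t _ => by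
      have h1 := wt_le_one hm₁ hm₂ (hϑ t)
      have h2 := wt_pos (m₁ := m₁) (m₂ := m₂) (hϑ t)
      have h3 := neg_one_le_cos (α t)
      nlinarith)
  have hw : Tendsto (fun t => wt m₁ m₂ (ϑ t)) atTop (𝓝 (wt m₁ m₂ L)) :=
    (continuous_wt.tendsto L).comp hL
  obtain ⟨β, hβ⟩ : ∃ β, Tendsto α atTop (𝓝 β) := by
    refine ⟨arccos (-p / wt m₁ m₂ L), ?_⟩
    have h1 : Tendsto (fun t => arccos (- -(wt m₁ m₂ (ϑ t) * cos (α t)) / wt m₁ m₂ (ϑ t))) atTop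
        (𝓝 (arccos (-p / wt m₁ m₂ L))) :=
      (continuous_arccos.tendsto _).comp (hp.neg.div hw hwL.ne')
    refine h1.congr' ?_
    filter_upwards [eventually_gt_atTop (0 : ℝ)] with t ht
    rw [neg_neg, mul_div_cancel_left₀ _ (wt_pos (hϑ t)).ne',
      arccos_cos (hf t ht).2.1.le (hf t ht).2.2.le]
  have hs2 : Tendsto (fun t => sin (2 * ϑ t)) atTop (𝓝 (sin (2 * L))) :=
    (continuous_sin.tendsto _).comp (hL.const_mul 2)
  have hsinβ := (continuous_sin.tendsto _).comp hβ
  have hcosβ := (continuous_cos.tendsto _).comp hβ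
  have hβ0 : 0 ≤ β := ge_of_tendsto hβ <| (eventually_gt_atTop 0).mono fun t ht => (hf t ht).2.1.le
  have hβπ : β ≤ π := le_of_tendsto hβ <| (eventually_gt_atTop 0).mono fun t ht => (hf t ht).2.2.le
  rcases hβ0.eq_or_lt with rfl | hβ0
  · rcases lt_or_ge (bal m₁ m₂ L) 0 with hQ | hQ
    · -- the first summand of `α'` is a bounded function times `sin α → 0`
      have hz : Tendsto (fun t => M * sin (2 * ϑ t) * tanh (a * ξ t) * sin (α t)) atTop (𝓝 0) := by
        refine bdd_le_mul_tendsto_zero' M (Eventually.of_forall fun t => ?_)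
          (by simpa using! hsinβ)
        rw [abs_mul, abs_mul, abs_of_pos hM]
        have h1 := abs_sin_le_one (2 * ϑ t)
        have h2 := (abs_tanh_lt_one (a * ξ t)).le
        calc _ ≤ M * 1 * 1 := by gcongr
          _ = M := by ring
      have hd : Tendsto (fun t => M * sin (2 * ϑ t) * tanh (a * ξ t) * sin (α t)
          + bal m₁ m₂ (ϑ t) * cos (α t)) atTop (𝓝 (bal m₁ m₂ L)) := by
        have := hz.add (((continuous_bal (m₁ := m₁) (m₂ := m₂).tendsto L).comp hL).mul hcosβ)
        simpa using! this
      exact not_bddAbove_of_tendsto_deriv (f := fun t => -α t) (B := 0) (u := 0)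
        (fun t => (h.profile.alpha t).neg) hd.neg (by linarith)
        (fun t ht => by linarith [(hf t ht).2.1])
    · have hQpos : ∀ t, 0 ≤ t → 0 < bal m₁ m₂ (ϑ t) := fun t ht =>
        hQ.trans_lt (bal_strictAntiOn hm₁ ⟨(hϑ t).1.le, (hϑ t).2.le⟩ ⟨hLmem.1.le, hLmem.2.le⟩
          (hlt t ht))
      obtain ⟨t₀, ht₀⟩ := eventually_atTop.1
        ((hβ.eventually_lt_const (by positivity : (0 : ℝ) < π / 2)).and (eventually_gt_atTop 0))
      have ht₀0 := (ht₀ t₀ le_rfl).2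
      have hge : ∀ t ≥ t₀, α t₀ ≤ α t := fun t ht =>
        le_of_hasDerivAt_nonneg ht (fun u _ => h.profile.alpha u) fun u hu => by
          have hu0 : 0 < u := ht₀0.trans hu.1
          have h1 := hsin u hu0
          have h2 := (hs u).le
          have h3 := tanh_nonneg_of_nonneg (mul_nonneg ha.le (hf u hu0).1.le)
          have h4 := hQpos u hu0.le
          have h5 : 0 < cos (α u) := cos_pos_of_mem_Ioo
            ⟨by linarith [(hf u hu0).2.1, pi_pos], (ht₀ u hu.1.le).1⟩
          positivity
      have := ge_of_tendsto hβ (eventually_atTop.2 ⟨t₀, hge⟩)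
      exact absurd (hf t₀ ht₀0).2.1 (not_lt.2 this)
  rcases hβπ.eq_or_lt with rfl | hβπ
  · exact not_bddAbove_of_tendsto_deriv (f := fun t => -ξ t) (B := 0) (u := 0)
      (fun t => (h.profile.xi t).neg) (hs2.mul hcosβ).neg (by simpa using hsL)
      (fun t ht => by linarith [(hf t ht).1])
  · exact not_bddAbove_of_tendsto_deriv (u := 0) h.profile.theta (hs2.mul hsinβ)
      (mul_pos hsL (sin_pos_of_pos_of_lt_pi hβ0 hβπ)) (fun t _ => (hϑ t).2.le)

/-- If there is no event, the momentum tends to `0`, hence is never negative. -/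
theorem IsProfileShot.cos_nonneg_of_forever (h : IsProfileShot M a m₁ m₂ δ ξ ϑ α)
    (hM : 0 < M) (ha : 0 < a) (hm₁ : 0 < m₁) (hm₂ : 0 < m₂) (hδ : δ ∈ Ioo 0 (π / 2))
    (hf : ∀ t > 0, 0 < ξ t ∧ α t ∈ Ioo 0 π) {t : ℝ} (ht : 0 < t) : 0 ≤ cos (α t) := by
  have hϑ := h.theta_mem hδ
  by_contra! hc
  have hw : Tendsto (fun u => wt m₁ m₂ (ϑ u)) atTop (𝓝 0) := by
    have := (continuous_wt (m₁ := m₁) (m₂ := m₂).tendsto _).comp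
      (h.tendsto_theta_of_forever hM ha hm₁ hm₂ hδ hf)
    rwa [wt_pi_div_two hm₂] at this
  have hP : Tendsto (fun u => wt m₁ m₂ (ϑ u) * cos (α u)) atTop (𝓝 0) := by
    have := bdd_le_mul_tendsto_zero' 1 (Eventually.of_forall fun u => abs_cos_le_one (α u)) hw
    simpa only [mul_comm] using this
  have hle : ∀ u ≥ t, wt m₁ m₂ (ϑ u) * cos (α u) ≤ wt m₁ m₂ (ϑ t) * cos (α t) := fun u hu =>
    h.profile.momentum_le hM.le ha.le (hϑ 0) hu fun v hv => (hf v (ht.trans hv.1)).1.le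
  have := le_of_tendsto hP (eventually_atTop.2 ⟨t, hle⟩)
  exact absurd (mul_neg_of_pos_of_neg (wt_pos (m₁ := m₁) (m₂ := m₂) (hϑ t)) hc) (not_lt.2 this)

/-! ### The way back to the axis -/

/-- Where `cos α ≤ 0` and the balance function is at most `-k`, the angle `α` grows at least as
fast as `ξ` decreases, up to the factor `s₀ / k`; as `α` has only `π` to grow, `ξ` loses at most
`s₀ π / k`. -/
theorem IsProfile.xi_drop_le (h : IsProfile M a m₁ m₂ ξ ϑ α) (hM : 0 < M) (ha : 0 < a)
    (h0 : ϑ 0 ∈ Ioo 0 (π / 2)) {t₀ T k s₀ : ℝ} (hT : t₀ ≤ T) (hk : 0 < k) (hs₀ : 0 ≤ s₀)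
    (hξ : ∀ t ∈ Icc t₀ T, 0 ≤ ξ t) (hα : ∀ t ∈ Icc t₀ T, α t ∈ Icc 0 π)
    (hQ : ∀ t ∈ Icc t₀ T, cos (α t) ≤ 0 → bal m₁ m₂ (ϑ t) ≤ -k ∧ sin (2 * ϑ t) ≤ s₀) :
    ξ t₀ - s₀ / k * π ≤ ξ T := by
  have hs : ∀ t, 0 < sin (2 * ϑ t) := fun t => sin_two_mul_pos (h.theta_mem h0 t)
  have hw : ∀ t, 0 < wt m₁ m₂ (ϑ t) := fun t => wt_pos (h.theta_mem h0 t)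
  have hP : ∀ u ∈ Icc t₀ T, ∀ v ∈ Icc t₀ T, u ≤ v →
      wt m₁ m₂ (ϑ v) * cos (α v) ≤ wt m₁ m₂ (ϑ u) * cos (α u) := fun u hu v hv huv =>
    h.momentum_le hM.le ha.le h0 huv fun t ht => hξ t ⟨hu.1.trans ht.1.le, ht.2.le.trans hv.2⟩
  have hsk : 0 ≤ s₀ / k := by positivity
  have hback : ∀ u ∈ Icc t₀ T, cos (α u) ≤ 0 → ξ u - s₀ / k * π ≤ ξ T := by
    intro u hu hcu
    have := le_of_hasDerivAt_nonneg (f := fun t => ξ t + s₀ / k * α t) hu.2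
      (fun t _ => (h.xi t).add ((h.alpha t).const_mul (s₀ / k))) fun t ht => by
        have htI : t ∈ Icc t₀ T := ⟨hu.1.trans ht.1.le, ht.2.le⟩
        have hct : cos (α t) ≤ 0 := by
          have h1 := hP u hu t htI ht.1.le
          have h2 := mul_nonpos_of_nonneg_of_nonpos (hw u).le hcu
          by_contra! hc
          linarith [mul_pos (hw t) hc]
        obtain ⟨hQ1, hQ2⟩ := hQ t htI hct
        have h1 : 0 ≤ M * sin (2 * ϑ t) * tanh (a * ξ t) * sin (α t) := by
          have := tanh_nonneg_of_nonneg (mul_nonneg ha.le (hξ t htI))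
          have := sin_nonneg_of_nonneg_of_le_pi (hα t htI).1 (hα t htI).2
          have := (hs t).le
          positivity
        have h2 : 0 ≤ (bal m₁ m₂ (ϑ t) + k) * cos (α t) :=
          mul_nonneg_of_nonpos_of_nonpos (by linarith) hct
        have h3 : 0 ≤ (sin (2 * ϑ t) - s₀) * cos (α t) :=
          mul_nonneg_of_nonpos_of_nonpos (by linarith) hct
        have h4 : s₀ / k * k = s₀ := div_mul_cancel₀ _ hk.ne'
        have h5 := mul_nonneg hsk (add_nonneg h1 h2)
        calc (0 : ℝ) ≤ _ := add_nonneg h5 h3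
          _ = _ := by linear_combination cos (α t) * h4
    have h1 := mul_nonneg hsk (hα u hu).1
    have h2 := mul_le_mul_of_nonneg_left (hα T ⟨hT, le_rfl⟩).2 hsk
    linarith
  have hforth : ∀ u ∈ Icc t₀ T, 0 ≤ cos (α u) → ξ t₀ ≤ ξ u := by
    intro u hu hcu
    refine le_of_hasDerivAt_nonneg hu.1 (fun t _ => h.xi t) fun t ht => ?_
    refine mul_nonneg (hs t).le ?_
    have h1 := hP t ⟨ht.1.le, ht.2.le.trans hu.2⟩ u hu ht.2.le
    have h2 := mul_nonneg (hw u).le hcu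
    by_contra! hc
    linarith [mul_neg_of_pos_of_neg (hw t) hc]
  have hpi : 0 ≤ s₀ / k * π := by positivity
  rcases le_or_gt 0 (cos (α T)) with hcT | hcT
  · linarith [hforth T ⟨hT, le_rfl⟩ hcT]
  rcases le_or_gt (cos (α t₀)) 0 with hc0 | hc0
  · exact hback t₀ ⟨le_rfl, hT⟩ hc0
  obtain ⟨u, hu, hcu⟩ := intermediate_value_Icc' hT
    (continuous_cos.comp h.continuous_alpha).continuousOn ⟨hcT.le, hc0.le⟩
  simp only [Function.comp_apply] at hcu
  linarith [hback u hu hcu.le, hforth u hu hcu.ge]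

/-! ### Solutions that return to the axis -/

/-- The solution returns to the axis `ξ = 0` before it is horizontal again. This is the condition
of type 1. -/
def ReturnsFirst (ξ α : ℝ → ℝ) : Prop := ∃ T > 0, ξ T = 0 ∧ ∀ t ∈ Ioo 0 T, sin (α t) ≠ 0

lemma IsProfileShot.exists_first_return (h : IsProfileShot M a m₁ m₂ δ ξ ϑ α)
    (hδ : δ ∈ Ioo 0 (π / 2)) (hQ : 0 < bal m₁ m₂ δ) (hr : ReturnsFirst ξ α) :
    ∃ T > 0, ξ T = 0 ∧ α T ∈ Icc 0 π ∧ ∀ t ∈ Ioo 0 T, 0 < ξ t ∧ α t ∈ Ioo 0 π := by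
  obtain ⟨T, hT, hξT, hne⟩ := hr
  rcases h.forever_or_first_event hδ hQ with hf | ⟨T₁, hT₁, hgood, -, hαT, hev⟩
  · exact absurd hξT (hf T hT).1.ne'
  have hle : T₁ ≤ T := by
    by_contra! hlt
    exact absurd hξT (hgood T ⟨hT, hlt⟩).1.ne'
  by_cases hz : ξ T₁ = 0
  · exact ⟨T₁, hT₁, hz, hαT, hgood⟩
  rcases hle.eq_or_lt with rfl | hlt
  · exact absurd hξT hz
  · refine absurd ?_ (hne T₁ ⟨hT₁, hlt⟩)
    rcases hev with he | he | he
    · exact absurd he hz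
    · rw [he, sin_zero]
    · rw [he, sin_pi]

lemma IsProfileShot.forever_or_horizontal (h : IsProfileShot M a m₁ m₂ δ ξ ϑ α)
    (hδ : δ ∈ Ioo 0 (π / 2)) (hQ : 0 < bal m₁ m₂ δ) (hr : ¬ ReturnsFirst ξ α) :
    (∀ t > 0, 0 < ξ t ∧ α t ∈ Ioo 0 π) ∨
    ∃ T > 0, (∀ t ∈ Ioo 0 T, 0 < ξ t ∧ α t ∈ Ioo 0 π) ∧ 0 < ξ T ∧ (α T = 0 ∨ α T = π) := by
  rcases h.forever_or_first_event hδ hQ with hf | ⟨T, hT, hgood, hξT, -, hev⟩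
  · exact Or.inl hf
  have hne : ξ T ≠ 0 := fun hz => hr ⟨T, hT, hz, fun t ht =>
    (sin_pos_of_pos_of_lt_pi (hgood t ht).2.1 (hgood t ht).2.2).ne'⟩
  exact Or.inr ⟨T, hT, hgood, lt_of_le_of_ne hξT hne.symm, hev.resolve_left hne⟩

/-- A solution can become horizontal only at a height where the balance function is not
positive. -/
lemma IsProfile.bal_nonpos_of_horizontal (h : IsProfile M a m₁ m₂ ξ ϑ α) {T : ℝ} (hT : 0 < T)
    (hgood : ∀ t ∈ Ioo 0 T, α t ∈ Ioo 0 π) (hα : α T = 0 ∨ α T = π) :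
    bal m₁ m₂ (ϑ T) ≤ 0 := by
  rcases hα with hα | hα
  · have := hasDerivAt_nonpos_of_pos_left hT (h.alpha T) hα fun t ht => (hgood t ht).1
    simpa [hα] using this
  · have := hasDerivAt_nonpos_of_pos_left hT ((h.alpha T).const_sub π) (by simp [hα])
      fun t ht => sub_pos.2 (hgood t ht).2
    simpa [hα] using this

/-! ### Small initial heights -/

/-- `(log tan ϑ)' = 2 sin α ≤ 2`: the logarithm of `tan ϑ` is a lower bound for the elapsed time. -/
lemma IsProfile.log_tan_sub_le (h : IsProfile M a m₁ m₂ ξ ϑ α) (h0 : ϑ 0 ∈ Ioo 0 (π / 2))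
    {u v : ℝ} (huv : u ≤ v) : log (tan (ϑ v)) - log (tan (ϑ u)) ≤ 2 * (v - u) := by
  have := le_of_hasDerivAt_nonneg (f := fun t => 2 * t - log (tan (ϑ t)))
    (f' := fun t => 2 * 1 - 2 * sin (α t)) huv
    (fun t _ => by
      have hs := sin_pos_of_mem (h.theta_mem h0 t)
      have hc := cos_pos_of_mem (h.theta_mem h0 t)
      have htan : tan (ϑ t) ≠ 0 := by rw [tan_eq_sin_div_cos]; positivity
      convert! ((hasDerivAt_id t).const_mul 2).sub
        (((hasDerivAt_tan hc.ne').comp t (h.theta t)).log htan) using 2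
      simp only [Function.comp_apply]
      rw [tan_eq_sin_div_cos, sin_two_mul]
      field_simp)
    (fun t _ => by linarith [sin_le_one (α t)])
  linarith

/-- The Riccati inequality `(ξ / P)' ≥ 2` for the momentum `P = w cos α`, as long as `P ≠ 0`. -/
lemma IsProfile.riccati (h : IsProfile M a m₁ m₂ ξ ϑ α) (hM : 0 < M) (ha : 0 < a)
    (hm₁ : 0 < m₁) (hm₂ : 0 < m₂) (h0 : ϑ 0 ∈ Ioo 0 (π / 2)) {u v : ℝ} (huv : u ≤ v)
    (hξ : ∀ t ∈ Icc u v, 0 ≤ ξ t) (hP : ∀ t ∈ Icc u v, cos (α t) ≠ 0) :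
    ξ u / (wt m₁ m₂ (ϑ u) * cos (α u)) + 2 * (v - u) ≤ ξ v / (wt m₁ m₂ (ϑ v) * cos (α v)) := by
  have hw : ∀ t, 0 < wt m₁ m₂ (ϑ t) := fun t => wt_pos (h.theta_mem h0 t)
  have := le_of_hasDerivAt_nonneg
    (f := fun t => ξ t / (wt m₁ m₂ (ϑ t) * cos (α t)) - 2 * t) huv
    (fun t ht => ((h.xi t).div (h.hasDerivAt_momentum t) (mul_ne_zero (hw t).ne' (hP t ht))).sub
      ((hasDerivAt_id t).const_mul 2)) fun t ht => by
      have htI := Ioo_subset_Icc_self ht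
      have hwt := hw t
      have hs := sin_two_mul_pos (h.theta_mem h0 t)
      have hct := hP t htI
      have h3 := tanh_nonneg_of_nonneg (mul_nonneg ha.le (hξ t htI))
      have h4 := hξ t htI
      have h5 := wt_le hm₁ hm₂ (h.theta_mem h0 t)
      set w := wt m₁ m₂ (ϑ t) with hwdef
      set s := sin (2 * ϑ t) with hsdef
      set c := cos (α t)
      have e : (s * c * (w * c) - ξ t * -(M * w * s * tanh (a * ξ t) * sin (α t) ^ 2)) /
          (w * c) ^ 2 = s / w + ξ t * (M * w * s * tanh (a * ξ t) * sin (α t) ^ 2) / (w * c) ^ 2 := by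
        field_simp
        ring
      rw [e]
      have h6 : 2 ≤ s / w := by rw [le_div_iff₀ hwt]; linarith
      have h7 : 0 ≤ ξ t * (M * w * s * tanh (a * ξ t) * sin (α t) ^ 2) / (w * c) ^ 2 := by
        positivity
      linarith
  linarith

/-- Near the boundary `ϑ = 0` the solution stays in a cone: as long as `cos α ≥ 0` and the balance
function is at least `1`, one has `ξ ≤ α sin 2ϑ`. -/
lemma IsProfileShot.xi_le_of_cone (h : IsProfileShot M a m₁ m₂ δ ξ ϑ α) (hM : 0 < M) (ha : 0 < a)
    (hδ : δ ∈ Ioo 0 (π / 2)) {v x : ℝ} (hv : 0 ≤ v) (hx : x ≤ π / 4)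
    (hQ : ∀ y ∈ Icc 0 x, 1 ≤ bal m₁ m₂ y) (hϑv : ϑ v ≤ x)
    (hg : ∀ t ∈ Icc 0 v, 0 ≤ ξ t ∧ α t ∈ Icc 0 π) (hc : ∀ t ∈ Icc 0 v, 0 ≤ cos (α t)) :
    ξ v ≤ sin (2 * ϑ v) * α v := by
  have hs : ∀ t, 0 < sin (2 * ϑ t) := fun t => sin_two_mul_pos (h.theta_mem hδ t)
  have hsin : ∀ t ∈ Icc 0 v, 0 ≤ sin (α t) := fun t ht =>
    sin_nonneg_of_nonneg_of_le_pi (hg t ht).2.1 (hg t ht).2.2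
  have := le_of_hasDerivAt_nonneg (f := fun t => sin (2 * ϑ t) * α t - ξ t) hv
    (fun t _ => (((h.profile.theta t).const_mul 2).sin.mul (h.profile.alpha t)).sub
      (h.profile.xi t)) fun t ht => by
      have htI := Ioo_subset_Icc_self ht
      have hϑt : ϑ t ≤ x := (le_of_hasDerivAt_nonneg ht.2.le (fun u _ => h.profile.theta u)
        fun u hu => mul_nonneg (hs u).le (hsin u ⟨ht.1.le.trans hu.1.le, hu.2.le⟩)).trans hϑv
      have h1 := hQ _ ⟨(h.theta_mem hδ t).1.le, hϑt⟩
      have h2 := hc t htI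
      have h3 := tanh_nonneg_of_nonneg (mul_nonneg ha.le (hg t htI).1)
      have h4 := hsin t htI
      have h5 := (hg t htI).2.1
      have h6 := (hs t).le
      have h7 : 0 ≤ cos (2 * ϑ t) := cos_nonneg_of_mem_Icc
        ⟨by linarith [(h.theta_mem hδ t).1, pi_pos], by linarith⟩
      have h8 : 0 ≤ sin (2 * ϑ t) * ((bal m₁ m₂ (ϑ t) - 1) * cos (α t)) :=
        mul_nonneg h6 (mul_nonneg (by linarith) h2)
      have h9 : 0 ≤ cos (2 * ϑ t) * (2 * (sin (2 * ϑ t) * sin (α t))) * α t := by positivity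
      have h10 : 0 ≤ sin (2 * ϑ t) * (M * sin (2 * ϑ t) * tanh (a * ξ t) * sin (α t)) := by
        positivity
      linarith
  simp only [h.xi_zero, h.alpha_zero] at this
  linarith

/-- The solution stays close to the axis up to the height `x'`: the cone estimate bounds `ξ` up to
the height `x`, and from there on `cos α ≤ w(δ) / w ≤ κ`. -/
lemma IsProfileShot.xi_le_of_small (h : IsProfileShot M a m₁ m₂ δ ξ ϑ α) (hM : 0 < M) (ha : 0 < a)
    (hδ : δ ∈ Ioo 0 (π / 2)) {v x x' κ : ℝ} (hv : 0 ≤ v) (hx : x ≤ π / 4) (hδx : δ ≤ x)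
    (hQ : ∀ y ∈ Icc 0 x, 1 ≤ bal m₁ m₂ y) (hκ : κ ≤ 1 / 2)
    (hw : ∀ y ∈ Icc x x', wt m₁ m₂ δ ≤ κ * wt m₁ m₂ y) (hϑv : ϑ v ≤ x')
    (hg : ∀ t ∈ Icc 0 v, 0 ≤ ξ t ∧ α t ∈ Icc 0 π) (hκ0 : 0 ≤ κ) :
    ∀ t ∈ Icc 0 v, ξ t ≤ 2 * π * x + κ * π := by
  have hϑ := h.theta_mem hδ
  have hs : ∀ t, 0 < sin (2 * ϑ t) := fun t => sin_two_mul_pos (hϑ t)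
  have hsin : ∀ t ∈ Icc 0 v, 0 ≤ sin (α t) := fun t ht =>
    sin_nonneg_of_nonneg_of_le_pi (hg t ht).2.1 (hg t ht).2.2
  have hmono : ∀ u w, 0 ≤ u → u ≤ w → w ≤ v → ϑ u ≤ ϑ w := fun u w hu huw hw =>
    le_of_hasDerivAt_nonneg huw (fun t _ => h.profile.theta t) fun t ht =>
      mul_nonneg (hs t).le (hsin t ⟨hu.trans ht.1.le, ht.2.le.trans hw⟩)
  have hx0 : 0 < x := hδ.1.trans_le hδx
  have hbound0 : 0 ≤ 2 * π * x + κ * π := by positivity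
  -- it suffices to bound `ξ` at its maximum, where `cos α ≥ 0`
  obtain ⟨u, hu, hmax⟩ := isCompact_Icc.exists_isMaxOn (nonempty_Icc.2 hv)
    h.profile.continuous_xi.continuousOn
  intro t ht
  refine (hmax ht).trans ?_
  rcases hu.1.eq_or_lt with rfl | hu0
  · rw [h.xi_zero]; exact hbound0
  have hcu : 0 ≤ cos (α u) := by
    by_contra! hneg
    have hd := ((h.profile.xi (u - 0)).comp_const_sub u 0).sub_const (ξ u)
    have hev := eventually_pos_right (f := fun r => ξ (u - r) - ξ u) hd (by simp)
      (by simpa using mul_neg_of_pos_of_neg (hs u) hneg)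
    obtain ⟨r, hr, hr'⟩ := (hev.and (Ioo_mem_nhdsGT hu0)).exists
    have : ξ (u - r) ≤ ξ u :=
      hmax (show u - r ∈ Icc 0 v from ⟨by linarith [hr'.2], by linarith [hr'.1, hu.2]⟩)
    linarith
  have hgu : ∀ t ∈ Icc 0 u, 0 ≤ ξ t ∧ α t ∈ Icc 0 π := fun t ht => hg t ⟨ht.1, ht.2.trans hu.2⟩
  have hP : ∀ p q, 0 ≤ p → p ≤ q → q ≤ u →
      wt m₁ m₂ (ϑ q) * cos (α q) ≤ wt m₁ m₂ (ϑ p) * cos (α p) := fun p q hp hpq hq =>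
    h.profile.momentum_le hM.le ha.le (hϑ 0) hpq fun t ht =>
      (hgu t ⟨hp.trans ht.1.le, ht.2.le.trans hq⟩).1
  have hcos : ∀ t ∈ Icc 0 u, 0 ≤ cos (α t) := by
    intro t ht
    by_contra! hneg
    have h1 := hP t u ht.1 ht.2 le_rfl
    have h2 := mul_neg_of_pos_of_neg (wt_pos (m₁ := m₁) (m₂ := m₂) (hϑ t)) hneg
    have h3 := mul_nonneg (wt_pos (m₁ := m₁) (m₂ := m₂) (hϑ u)).le hcu
    linarith
  have hcone : ∀ p, 0 ≤ p → p ≤ u → ϑ p ≤ x → ξ p ≤ 2 * π * x := by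
    intro p hp hpu hpx
    have h1 := h.xi_le_of_cone hM ha hδ hp hx hQ hpx
      (fun t ht => hgu t ⟨ht.1, ht.2.trans hpu⟩) (fun t ht => hcos t ⟨ht.1, ht.2.trans hpu⟩)
    have h2 : sin (2 * ϑ p) ≤ 2 * x := (sin_le (by linarith [(hϑ p).1])).trans (by linarith)
    have h3 := (hgu p ⟨hp, hpu⟩).2
    calc ξ p ≤ sin (2 * ϑ p) * α p := h1
      _ ≤ 2 * x * π := mul_le_mul h2 h3.2 h3.1 (by positivity)
      _ = _ := by ring
  rcases le_or_gt (ϑ u) x with hux | hux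
  · have := hcone u hu0.le le_rfl hux
    have : 0 ≤ κ * π := by positivity
    linarith
  obtain ⟨p, hp, hpx⟩ := intermediate_value_Icc hu0.le h.profile.continuous_theta.continuousOn
    (show x ∈ Icc (ϑ 0) (ϑ u) from ⟨by rwa [h.theta_zero], hux.le⟩)
  have h1 := hcone p hp.1 hp.2 hpx.le
  have h2 := le_of_hasDerivAt_nonneg (f := fun t => 2 * κ * ϑ t - ξ t) hp.2
    (fun t _ => ((h.profile.theta t).const_mul (2 * κ)).sub (h.profile.xi t)) fun t ht => by
      have htI : t ∈ Icc 0 u := ⟨hp.1.trans ht.1.le, ht.2.le⟩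
      have hxt : x ≤ ϑ t := hpx ▸ hmono p t hp.1 ht.1.le (ht.2.le.trans hu.2)
      have hwt := wt_pos (m₁ := m₁) (m₂ := m₂) (hϑ t)
      have h3 : wt m₁ m₂ (ϑ t) * cos (α t) ≤ κ * wt m₁ m₂ (ϑ t) := by
        have := hP 0 t le_rfl htI.1 htI.2
        rw [h.theta_zero, h.alpha_zero, cos_zero, mul_one] at this
        exact this.trans (hw _ ⟨hxt, (hmono t v htI.1 (htI.2.trans hu.2) le_rfl).trans hϑv⟩)
      have h4 : cos (α t) ≤ κ := by
        rw [mul_comm] at h3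
        exact le_of_mul_le_mul_right h3 hwt
      have h5 := hcos t htI
      have h6 := hsin t ⟨htI.1, htI.2.trans hu.2⟩
      have h7 : 1 / 2 ≤ sin (α t) := by nlinarith [sin_sq_add_cos_sq (α t)]
      have h8 : cos (α t) ≤ 2 * κ * sin (α t) := by nlinarith
      have := mul_le_mul_of_nonneg_left h8 (hs t).le
      linarith
  have h3 := (hϑ u).2
  have h4 := (hϑ p).1
  have h5 : 2 * κ * (ϑ u - ϑ p) ≤ 2 * κ * (π / 2) := by gcongr; linarith
  linarith

/-- The weight is bounded below on compact parts of the open strip. -/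
lemma exists_wt_lower_bound (m₁ m₂ : ℕ) {x y : ℝ} (hx : 0 < x) (hy : y < π / 2) :
    ∃ b > 0, ∀ z ∈ Icc x y, b ≤ wt m₁ m₂ z := by
  rcases lt_or_ge y x with hxy | hxy
  · exact ⟨1, one_pos, fun z hz => absurd (hz.1.trans hz.2) (not_le.2 hxy)⟩
  obtain ⟨z, hz, hmin⟩ := isCompact_Icc.exists_isMinOn (nonempty_Icc.2 hxy)
    (continuous_wt (m₁ := m₁) (m₂ := m₂)).continuousOn
  exact ⟨wt m₁ m₂ z, wt_pos ⟨hx.trans_le hz.1, hz.2.trans_lt hy⟩, fun u hu => hmin hu⟩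

/-- While `ξ` is small and `sin α ≥ 1/2`, the Riccati quotient `P / ξ` decreases at a definite
rate with respect to `ϑ`. -/
lemma IsProfile.riccati_drop (h : IsProfile M a m₁ m₂ ξ ϑ α) (hM : 0 < M) (ha : 0 < a)
    (h0 : ϑ 0 ∈ Ioo 0 (π / 2)) {u v b : ℝ} (huv : u ≤ v) (hb : 0 < b)
    (hξ : ∀ t ∈ Icc u v, 0 < ξ t) (hξ' : ∀ t ∈ Icc u v, a * ξ t ≤ 1 / 2)
    (hw : ∀ t ∈ Icc u v, b ≤ wt m₁ m₂ (ϑ t)) (hα : ∀ t ∈ Icc u v, 1 / 2 ≤ sin (α t)) :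
    wt m₁ m₂ (ϑ v) * cos (α v) / ξ v + M * a * b / 4 * (ϑ v - ϑ u) ≤
      wt m₁ m₂ (ϑ u) * cos (α u) / ξ u := by
  have := ge_of_hasDerivAt_nonpos
    (f := fun t => wt m₁ m₂ (ϑ t) * cos (α t) / ξ t + M * a * b / 4 * ϑ t) huv
    (fun t ht => ((h.hasDerivAt_momentum t).div (h.xi t) (hξ t ht).ne').add
      ((h.theta t).const_mul (M * a * b / 4))) fun t ht => by
      have htI := Ioo_subset_Icc_self ht
      have hwb := hw t htI
      have hw0 : 0 < wt m₁ m₂ (ϑ t) := hb.trans_le hwb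
      have hs := sin_two_mul_pos (h.theta_mem h0 t)
      have hx := hξ t htI
      have hS := hα t htI
      have htanh := half_le_tanh (mul_nonneg ha.le hx.le) (hξ' t htI)
      set w := wt m₁ m₂ (ϑ t)
      set s := sin (2 * ϑ t)
      set S := sin (α t)
      set x := ξ t
      have e : (-(M * w * s * tanh (a * x) * S ^ 2) * x - w * cos (α t) * (s * cos (α t))) / x ^ 2 +
          M * a * b / 4 * (s * S) = -(M * s * S * (w * S * tanh (a * x) - b * (a * x) / 4)) / x
            - w * s * cos (α t) ^ 2 / x ^ 2 := by
        field_simp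
        ring
      rw [e]
      have h1 : b * (1 / 2) * (a * x / 2) ≤ w * S * tanh (a * x) := by gcongr
      have h2 : 0 ≤ M * s * S * (w * S * tanh (a * x) - b * (a * x) / 4) / x :=
        div_nonneg (mul_nonneg (by positivity) (by linarith)) hx.le
      have h3 : 0 ≤ w * s * cos (α t) ^ 2 / x ^ 2 := by positivity
      rw [neg_div]
      linarith
  linarith

/-- A solution starting close enough to `ϑ = 0` cannot reach the height `x₄` without returning to
the axis. It needs a long time to leave the boundary `ϑ = 0`, so the Riccati quotient
`R = P / ξ` is at most `r` at height `π/6`; it is at most `-r` at height `π/4`, and then blows up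
before the height `x₄`, which forces `ξ` to vanish. -/
theorem IsProfileShot.not_reaches (h : IsProfileShot M a m₁ m₂ δ ξ ϑ α) (hM : 0 < M) (ha : 0 < a)
    (hm₁ : 0 < m₁) (hm₂ : 0 < m₂) (hδI : δ ∈ Ioo 0 (π / 2)) {w₁ r x₄ t₄ : ℝ} (hw₁ : 0 < w₁)
    (hw₁le : ∀ z ∈ Icc (π / 6) (π / 4), w₁ ≤ wt m₁ m₂ z) (hr : r = M * a * w₁ / 4 * (π / 24))
    (hx₄log : 1 / r < log (tan x₄)) (hx₄ : π / 4 < x₄) (hδ6 : δ < π / 6)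
    (hδlog : log (tan δ) ≤ log (tan (π / 6)) - 1 / r) (ht₄ : 0 < t₄) (hϑ4 : ϑ t₄ = x₄)
    (hg : ∀ t ∈ Ioc 0 t₄, 0 < ξ t ∧ α t ∈ Ioo 0 π) (hclose : ∀ t ∈ Icc 0 t₄, a * ξ t ≤ 1 / 2)
    (hsteep : ∀ t ∈ Icc 0 t₄, ϑ t ∈ Icc (π / 6) (π / 4) → |cos (α t)| ≤ 1 / 2) : False := by
  have hpi := pi_pos
  have hr0 : 0 < r := by rw [hr]; positivity
  have hϑ := h.theta_mem hδI
  have h0 := hϑ 0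
  have hg' : ∀ t ∈ Icc 0 t₄, 0 ≤ ξ t ∧ α t ∈ Icc 0 π := by
    intro t ht
    rcases ht.1.eq_or_lt with rfl | h1
    · simp [h.xi_zero, h.alpha_zero, hpi.le]
    · exact ⟨(hg t ⟨h1, ht.2⟩).1.le, Ioo_subset_Icc_self (hg t ⟨h1, ht.2⟩).2⟩
  have hmono : ∀ u v, 0 ≤ u → u ≤ v → v ≤ t₄ → ϑ u ≤ ϑ v := fun u v hu huv hv =>
    le_of_hasDerivAt_nonneg huv (fun t _ => h.profile.theta t) fun t ht => by
      have htI := hg' t ⟨hu.trans ht.1.le, ht.2.le.trans hv⟩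
      exact mul_nonneg (sin_two_mul_pos (hϑ t)).le
        (sin_nonneg_of_nonneg_of_le_pi htI.2.1 htI.2.2)
  obtain ⟨t₃, ht₃, hϑ3⟩ := intermediate_value_Ioo ht₄.le h.profile.continuous_theta.continuousOn
    (show π / 4 ∈ Ioo (ϑ 0) (ϑ t₄) from ⟨by rw [h.theta_zero]; linarith, by rw [hϑ4]; linarith⟩)
  obtain ⟨t₁, ht₁, hϑ1⟩ := intermediate_value_Ioo ht₃.1.le h.profile.continuous_theta.continuousOn
    (show π / 6 ∈ Ioo (ϑ 0) (ϑ t₃) from ⟨by rw [h.theta_zero]; linarith, by rw [hϑ3]; linarith⟩)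
  have hξpos : ∀ t ∈ Ioc 0 t₄, 0 < ξ t := fun t ht => (hg t ht).1
  have hP : ∀ u v, 0 ≤ u → u ≤ v → v ≤ t₄ →
      wt m₁ m₂ (ϑ v) * cos (α v) ≤ wt m₁ m₂ (ϑ u) * cos (α u) := fun u v hu huv hv =>
    h.profile.momentum_le hM.le ha.le h0 huv fun t ht =>
      (hg' t ⟨hu.trans ht.1.le, ht.2.le.trans hv⟩).1
  have hwpos : ∀ t, 0 < wt m₁ m₂ (ϑ t) := fun t => wt_pos (hϑ t)
  have ht₁4 : t₁ < t₄ := ht₁.2.trans ht₃.2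
  have hξ1 := hξpos t₁ ⟨ht₁.1, ht₁4.le⟩
  have hξ3 := hξpos t₃ ⟨ht₃.1, ht₃.2.le⟩
  have hξ4 := hξpos t₄ ⟨ht₄, le_rfl⟩
  -- `R ≤ r` at height `π/6`
  have hR1 : wt m₁ m₂ (ϑ t₁) * cos (α t₁) / ξ t₁ ≤ r := by
    rcases le_or_gt (cos (α t₁)) 0 with hneg | hpos
    · exact (div_nonpos_of_nonpos_of_nonneg
        (mul_nonpos_of_nonneg_of_nonpos (hwpos t₁).le hneg) hξ1.le).trans hr0.le
    have hP1 := mul_pos (hwpos t₁) hpos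
    have h1 := h.profile.riccati hM ha hm₁ hm₂ h0 ht₁.1.le
      (fun t ht => (hg' t ⟨ht.1, ht.2.trans ht₁4.le⟩).1) (fun t ht hz => by
        have := hP t t₁ ht.1 ht.2 ht₁4.le
        rw [hz, mul_zero] at this
        linarith)
    have h2 := h.profile.log_tan_sub_le h0 ht₁.1.le
    rw [h.theta_zero, hϑ1] at h2
    rw [h.xi_zero, zero_div, zero_add] at h1
    have h3 : 1 / r ≤ ξ t₁ / (wt m₁ m₂ (ϑ t₁) * cos (α t₁)) := by linarith
    rw [div_le_div_iff₀ hr0 hP1] at h3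
    rw [div_le_iff₀ hξ1]
    linarith
  -- `R ≤ -r` at height `π/4`
  have hR3 : wt m₁ m₂ (ϑ t₃) * cos (α t₃) / ξ t₃ ≤ -r := by
    have hI : ∀ t ∈ Icc t₁ t₃, t ∈ Icc 0 t₄ ∧ ϑ t ∈ Icc (π / 6) (π / 4) := fun t ht =>
      ⟨⟨ht₁.1.le.trans ht.1, ht.2.trans ht₃.2.le⟩,
        hϑ1 ▸ hmono t₁ t ht₁.1.le ht.1 (ht.2.trans ht₃.2.le),
        hϑ3 ▸ hmono t t₃ (ht₁.1.le.trans ht.1) ht.2 ht₃.2.le⟩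
    have h1 := h.profile.riccati_drop hM ha h0 ht₁.2.le hw₁
      (fun t ht => hξpos t ⟨ht₁.1.trans_le ht.1, (hI t ht).1.2⟩)
      (fun t ht => hclose t (hI t ht).1)
      (fun t ht => hw₁le _ (hI t ht).2)
      (fun t ht => by
        have hc2 := hsteep t (hI t ht).1 (hI t ht).2
        have hs0 := sin_nonneg_of_nonneg_of_le_pi (hg' t (hI t ht).1).2.1
          (hg' t (hI t ht).1).2.2
        rw [abs_le] at hc2
        nlinarith [sin_sq_add_cos_sq (α t)])
    rw [hϑ1, hϑ3] at h1
    rw [hϑ3]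
    rw [hϑ1] at hR1
    have h2 : M * a * w₁ / 4 * (π / 4 - π / 6) = 2 * r := by rw [hr]; ring
    linarith
  -- from then on `1 / R` increases at least at the rate `2` and is negative
  have hneg3 : wt m₁ m₂ (ϑ t₃) * cos (α t₃) < 0 := by
    by_contra! hge
    linarith [div_nonneg hge hξ3.le]
  have h1 := h.profile.riccati hM ha hm₁ hm₂ h0 ht₃.2.le
    (fun t ht => (hg' t ⟨ht₃.1.le.trans ht.1, ht.2⟩).1) (fun t ht hz => by
      have := hP t₃ t ht₃.1.le ht.1 ht.2
      rw [hz, mul_zero] at this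
      linarith)
  have h2 := h.profile.log_tan_sub_le h0 ht₃.2.le
  rw [hϑ4, hϑ3, tan_pi_div_four, log_one, sub_zero] at h2
  have h3 : ξ t₄ / (wt m₁ m₂ (ϑ t₄) * cos (α t₄)) ≤ 0 :=
    div_nonpos_of_nonneg_of_nonpos hξ4.le ((hP t₃ t₄ ht₃.1.le ht₃.2.le le_rfl).trans hneg3.le)
  have h4 : -(1 / r) ≤ ξ t₃ / (wt m₁ m₂ (ϑ t₃) * cos (α t₃)) := by
    rw [div_le_iff₀ hξ3] at hR3
    rw [le_div_iff_of_neg hneg3]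
    have : -(1 / r) * (-r * ξ t₃) = ξ t₃ := by field_simp
    have h5 : -(1 / r) ≤ 0 := by simpa using hr0.le
    have h6 := mul_le_mul_of_nonpos_left hR3 h5
    linarith
  linarith

/-- For small `δ` the solution returns to the axis: otherwise it would reach any given height
below `π/2`, staying close to the axis, which `IsProfileShot.not_reaches` excludes. -/
theorem eventually_returnsFirst (hM : 0 < M) (ha : 0 < a) (hm₁ : 0 < m₁) (hm₂ : 0 < m₂) :
    ∀ᶠ δ in 𝓝[>] (0 : ℝ), ∀ ξ ϑ α : ℝ → ℝ, IsProfileShot M a m₁ m₂ δ ξ ϑ α →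
      ReturnsFirst ξ α := by
  have hpi := pi_pos
  obtain ⟨c, hc, hcQ⟩ := exists_bal_eq_zero hm₁ hm₂
  obtain ⟨w₁, hw₁, hw₁le⟩ := exists_wt_lower_bound m₁ m₂ (x := π / 6) (y := π / 4)
    (by positivity) (by linarith)
  -- the values `R ≤ r` at height `π/6` and `R ≤ -r` at height `π/4`
  obtain ⟨r, hr⟩ : ∃ r, r = M * a * w₁ / 4 * (π / 24) := ⟨_, rfl⟩
  have hr0 : 0 < r := by rw [hr]; positivity
  obtain ⟨x₄, hx₄log, hx₄⟩ : ∃ x₄, 1 / r < log (tan x₄) ∧ x₄ ∈ Ioo (max (π / 4) c) (π / 2) :=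
    (((tendsto_log_atTop.comp tendsto_tan_pi_div_two).eventually_gt_atTop (1 / r)).and
      (Ioo_mem_nhdsLT (max_lt (by linarith) hc.2))).exists
  have hx₄1 : π / 4 < x₄ := (le_max_left _ _).trans_lt hx₄.1
  have hx₄c : c < x₄ := (le_max_right _ _).trans_lt hx₄.1
  obtain ⟨w₂, hw₂, hw₂le⟩ := exists_wt_lower_bound m₁ m₂ (x := min (π / 6) c) (y := x₄)
    (lt_min (by positivity) hc.1) hx₄.2
  set ε := min (1 / (2 * a)) (w₂ / (M * a * π)) with hε
  have hε0 : 0 < ε := lt_min (by positivity) (by positivity)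
  have hε1 : a * ε ≤ 1 / 2 := by
    calc a * ε ≤ a * (1 / (2 * a)) := by gcongr; exact min_le_left _ _
      _ = 1 / 2 := by field_simp
  have hε2 : M * (a * ε) * (π / 2) ≤ w₂ / 2 := by
    calc M * (a * ε) * (π / 2) ≤ M * (a * (w₂ / (M * a * π))) * (π / 2) := by
          gcongr; exact min_le_right _ _
      _ = w₂ / 2 := by field_simp
  obtain ⟨x₅, hx₅0, hx₅4, hx₅ε, hx₅Q⟩ : ∃ x₅ > 0, x₅ ≤ π / 4 ∧ 2 * π * x₅ ≤ ε / 2 ∧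
      ∀ y ∈ Icc 0 x₅, 1 ≤ bal m₁ m₂ y := by
    have h1 : 1 < bal m₁ m₂ 0 := by
      have : (1 : ℝ) ≤ m₁ := by exact_mod_cast hm₁
      simp only [bal, cos_zero, sin_zero]
      linarith
    obtain ⟨η, hη, hball⟩ := Metric.eventually_nhds_iff.1
      ((continuous_bal.tendsto 0).eventually_const_lt h1)
    refine ⟨min (η / 2) (min (π / 4) (ε / (4 * π))), by positivity,
      (min_le_right _ _).trans (min_le_left _ _), ?_, fun y hy => (hball ?_).le⟩
    · calc 2 * π * min (η / 2) (min (π / 4) (ε / (4 * π))) ≤ 2 * π * (ε / (4 * π)) := by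
            gcongr; exact (min_le_right _ _).trans (min_le_right _ _)
        _ = ε / 2 := by field_simp; norm_num
    · have := hy.2.trans (min_le_left _ _)
      rw [Real.dist_eq, sub_zero, abs_of_nonneg hy.1]
      linarith
  obtain ⟨w₃, hw₃, hw₃le⟩ := exists_wt_lower_bound m₁ m₂ (x := x₅) (y := x₄) hx₅0 hx₄.2
  set κ := min (1 / 2) (ε / (2 * π)) with hκ
  have hκ0 : 0 < κ := lt_min (by positivity) (by positivity)
  have hκε : κ * π ≤ ε / 2 := by
    calc κ * π ≤ ε / (2 * π) * π := by gcongr; exact min_le_right _ _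
      _ = ε / 2 := by field_simp
  -- the smallness conditions on `δ`
  have hwt0 : Tendsto (wt m₁ m₂) (𝓝[>] 0) (𝓝 0) := by
    have := (continuous_wt (m₁ := m₁) (m₂ := m₂)).tendsto 0
    simp only [wt, sin_zero, zero_pow hm₁.ne', zero_mul] at this
    exact this.mono_left nhdsWithin_le_nhds
  have htan0 : Tendsto (fun δ => log (tan δ)) (𝓝[>] 0) atBot := by
    refine tendsto_log_nhdsGT_zero.comp (tendsto_nhdsWithin_iff.2 ⟨?_, ?_⟩)
    · have := (continuousAt_tan.2 (by simp : cos 0 ≠ 0)).tendsto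
      rw [tan_zero] at this
      exact this.mono_left nhdsWithin_le_nhds
    · filter_upwards [Ioo_mem_nhdsGT (by positivity : (0 : ℝ) < π / 2)] with δ hδ
      exact tan_pos_of_pos_of_lt_pi_div_two hδ.1 hδ.2
  have hsmall : (0 : ℝ) < min x₅ (min (π / 6) c) := by
    have := hc.1
    positivity
  filter_upwards [Ioo_mem_nhdsGT hsmall, hwt0.eventually_lt_const (half_pos hw₂),
    hwt0.eventually_lt_const (mul_pos hκ0 hw₃),
    htan0.eventually_le_atBot (log (tan (π / 6)) - 1 / r)] with δ hδ hδ₂ hδ₃ hδlog ξ ϑ α h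
  have hδ5 : δ < x₅ := hδ.2.trans_le (min_le_left _ _)
  have hδ6 : δ < π / 6 := hδ.2.trans_le ((min_le_right _ _).trans (min_le_left _ _))
  have hδc : δ < c := hδ.2.trans_le ((min_le_right _ _).trans (min_le_right _ _))
  have hδI : δ ∈ Ioo 0 (π / 2) := ⟨hδ.1, by linarith⟩
  have hϑ := h.theta_mem hδI
  have h0 := hϑ 0
  have hQδ : 0 < bal m₁ m₂ δ := hcQ ▸ bal_strictAntiOn hm₁ ⟨hδI.1.le, hδI.2.le⟩
    ⟨hc.1.le, hc.2.le⟩ hδc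
  -- up to the height `x₄` the solution stays close to the axis
  have hclose : ∀ v, 0 ≤ v → ϑ v ≤ x₄ → (∀ t ∈ Icc 0 v, 0 ≤ ξ t ∧ α t ∈ Icc 0 π) →
      ∀ t ∈ Icc 0 v, ξ t ≤ ε := fun v hv hϑv hg t ht =>
    (h.xi_le_of_small hM ha hδI hv hx₅4 hδ5.le hx₅Q (min_le_left _ _)
      (fun y hy => hδ₃.le.trans (by gcongr; exact hw₃le y hy)) hϑv hg hκ0.le t ht).trans
      (by linarith)
  -- hence `α` stays close to `π/2`
  have hsteep : ∀ v, 0 ≤ v → ϑ v ≤ x₄ → (∀ t ∈ Icc 0 v, 0 ≤ ξ t ∧ α t ∈ Icc 0 π) →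
      min (π / 6) c ≤ ϑ v → |cos (α v)| ≤ 1 / 2 := by
    intro v hv hϑv hg hlow
    have hwv := hw₂le (ϑ v) ⟨hlow, hϑv⟩
    have hup := h.profile.momentum_le hM.le ha.le h0 hv
      (fun t ht => (hg t (Ioo_subset_Icc_self ht)).1)
    have hlo := h.profile.le_momentum hM.le hm₁ hm₂ h0 (B := a * ε) hv (by positivity)
      (fun t ht => by
        have hξ := (hg t (Ioo_subset_Icc_self ht)).1
        exact (tanh_le_self (mul_nonneg ha.le hξ)).trans
          (by gcongr; exact hclose v hv hϑv hg t (Ioo_subset_Icc_self ht)))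
      (fun t ht => sin_nonneg_of_nonneg_of_le_pi (hg t (Ioo_subset_Icc_self ht)).2.1
        (hg t (Ioo_subset_Icc_self ht)).2.2)
    rw [h.theta_zero, h.alpha_zero, cos_zero, mul_one] at hup hlo
    have hwδ := wt_pos (m₁ := m₁) (m₂ := m₂) hδI
    have h1 : M * (a * ε) * (ϑ v - δ) ≤ M * (a * ε) * (π / 2) := by
      gcongr; linarith [(hϑ v).2, hδ.1]
    rw [abs_le]
    constructor <;> by_contra! hlt
    · nlinarith
    · nlinarith
  by_contra hnr
  -- the solution reaches the height `x₄`
  obtain ⟨t₄, ht₄, hϑ4, hg⟩ : ∃ t₄ > 0, ϑ t₄ = x₄ ∧ ∀ t ∈ Ioc 0 t₄, 0 < ξ t ∧ α t ∈ Ioo 0 π := by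
    have hivt : ∀ v, 0 < v → x₄ < ϑ v → ∃ t ∈ Ioo 0 v, ϑ t = x₄ := fun v hv hlt =>
      intermediate_value_Ioo hv.le h.profile.continuous_theta.continuousOn
        ⟨by rw [h.theta_zero]; linarith, hlt⟩
    rcases h.forever_or_horizontal hδI hQδ hnr with hf | ⟨T, hT, hgood, hξT, hαT⟩
    · obtain ⟨v, hv, hv0⟩ := (((h.tendsto_theta_of_forever hM ha hm₁ hm₂ hδI hf).eventually_const_lt
        hx₄.2).and (eventually_gt_atTop 0)).exists
      obtain ⟨t, ht, hte⟩ := hivt v hv0 hv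
      exact ⟨t, ht.1, hte, fun u hu => hf u hu.1⟩
    · have hQT := h.profile.bal_nonpos_of_horizontal hT (fun t ht => (hgood t ht).2) hαT
      have hcT : c ≤ ϑ T := by
        by_contra! hlt
        have := bal_strictAntiOn (m₁ := m₁) (m₂ := m₂) hm₁ ⟨(hϑ T).1.le, (hϑ T).2.le⟩
          ⟨hc.1.le, hc.2.le⟩ hlt
        linarith
      have hgT : ∀ t ∈ Icc 0 T, 0 ≤ ξ t ∧ α t ∈ Icc 0 π := by
        intro t ht
        rcases ht.1.eq_or_lt with rfl | h1
        · simp [h.xi_zero, h.alpha_zero, hpi.le]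
        rcases ht.2.eq_or_lt with rfl | h2
        · exact ⟨hξT.le, by rcases hαT with e | e <;> simp [e, hpi.le]⟩
        · exact ⟨(hgood t ⟨h1, h2⟩).1.le, Ioo_subset_Icc_self (hgood t ⟨h1, h2⟩).2⟩
      have hlt : x₄ < ϑ T := by
        by_contra! hle
        have := hsteep T hT.le hle hgT ((min_le_right _ _).trans hcT)
        rcases hαT with e | e <;> rw [e] at this <;> norm_num at this
      obtain ⟨t, ht, hte⟩ := hivt T hT hlt
      exact ⟨t, ht.1, hte, fun u hu => hgood u ⟨hu.1, hu.2.trans_lt ht.2⟩⟩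
  have hg' : ∀ t ∈ Icc 0 t₄, 0 ≤ ξ t ∧ α t ∈ Icc 0 π := by
    intro t ht
    rcases ht.1.eq_or_lt with rfl | h1
    · simp [h.xi_zero, h.alpha_zero, hpi.le]
    · exact ⟨(hg t ⟨h1, ht.2⟩).1.le, Ioo_subset_Icc_self (hg t ⟨h1, ht.2⟩).2⟩
  exact h.not_reaches hM ha hm₁ hm₂ hδI hw₁ hw₁le hr hx₄log hx₄1 hδ6 hδlog ht₄ hϑ4 hg
    (fun t ht => (mul_le_mul_of_nonneg_left (hclose t₄ ht₄.le hϑ4.le hg' t ht) ha.le).trans hε1)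
    (fun t ht hI => hsteep t ht.1 (hI.2.trans hx₄1.le)
      (fun u hu => hg' u ⟨hu.1, hu.2.trans ht.2⟩) ((min_le_left _ _).trans hI.1))

variable {Ξ Θ A : ℝ → ℝ → ℝ}

/-! ### Perturbation of the initial height -/

lemma IsShotFamily.continuous (h : IsShotFamily M a m₁ m₂ Ξ Θ A) :
    Continuous fun p : ℝ × ℝ => (Ξ p.1 (max p.2 0), Θ p.1 (max p.2 0), A p.1 (max p.2 0)) :=
  h.continuousOn.comp_continuous (f := fun p : ℝ × ℝ => (p.1, max p.2 0)) (by fun_prop)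
    fun p => ⟨mem_univ _, le_max_right p.2 0⟩

lemma IsShotFamily.continuous_xi (h : IsShotFamily M a m₁ m₂ Ξ Θ A) :
    Continuous fun p : ℝ × ℝ => Ξ p.1 (max p.2 0) := h.continuous.fst

lemma IsShotFamily.continuous_theta (h : IsShotFamily M a m₁ m₂ Ξ Θ A) :
    Continuous fun p : ℝ × ℝ => Θ p.1 (max p.2 0) := h.continuous.snd.fst

lemma IsShotFamily.continuous_alpha (h : IsShotFamily M a m₁ m₂ Ξ Θ A) :
    Continuous fun p : ℝ × ℝ => A p.1 (max p.2 0) := h.continuous.snd.snd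

lemma continuous_slice {F : ℝ → ℝ → ℝ} (hF : Continuous fun p : ℝ × ℝ => F p.1 (max p.2 0))
    {t : ℝ} (ht : 0 ≤ t) : Continuous fun δ => F δ t := by
  have := hF.comp (Continuous.prodMk_left t)
  simpa [Function.comp_def, max_eq_left ht] using this

/-- A strict lower bound on a compact time interval persists under a change of the parameter. -/
lemma eventually_forall_Icc_lt {F : ℝ → ℝ → ℝ}
    (hF : Continuous fun p : ℝ × ℝ => F p.1 (max p.2 0)) {δ u v B : ℝ} (hu : 0 ≤ u)
    (h : ∀ t ∈ Icc u v, B < F δ t) : ∀ᶠ δ' in 𝓝 δ, ∀ t ∈ Icc u v, B < F δ' t := by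
  have := isCompact_Icc.eventually_forall_of_forall_eventually (K := Icc u v) (x₀ := δ)
    (P := fun δ' t => B < F δ' (max t 0)) fun t ht => by
      have h1 : B < F δ (max t 0) := by rw [max_eq_left (hu.trans ht.1)]; exact h t ht
      exact (hF.tendsto (δ, t)).eventually_const_lt h1
  filter_upwards [this] with δ' h' t ht
  have := h' t ht
  rwa [max_eq_left (hu.trans ht.1)] at this

/-- Positivity on `(0, t₀]` of a function with `F(0) = 0`, `F'(0) > 0` persists under a change of
the parameter. -/
lemma eventually_forall_Ioc_pos {F F' : ℝ → ℝ → ℝ}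
    (hF : Continuous fun p : ℝ × ℝ => F p.1 (max p.2 0))
    (hF' : Continuous fun p : ℝ × ℝ => F' p.1 (max p.2 0))
    (hd : ∀ δ t, HasDerivAt (F δ) (F' δ t) t) (hz : ∀ δ, F δ 0 = 0) {δ t₀ : ℝ}
    (h0 : 0 < F' δ 0) (h : ∀ t ∈ Ioc 0 t₀, 0 < F δ t) :
    ∀ᶠ δ' in 𝓝 δ, ∀ t ∈ Ioc 0 t₀, 0 < F δ' t := by
  obtain ⟨τ, hτ, hball⟩ := Metric.eventually_nhds_iff.1
    ((hF'.tendsto (δ, 0)).eventually_const_lt (by simpa using h0))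
  filter_upwards [Metric.ball_mem_nhds δ hτ, eventually_forall_Icc_lt hF (u := τ / 2) (v := t₀)
    (half_pos hτ).le fun t ht => h t ⟨(half_pos hτ).trans_le ht.1, ht.2⟩] with δ' hδ' hI t ht
  rcases le_or_gt (τ / 2) t with hlt | hlt
  · exact hI t ⟨hlt, ht.2⟩
  · have := lt_of_hasDerivAt_pos ht.1 (fun u _ => hd δ' u) fun u hu => by
      have hdist : dist (δ', u) (δ, 0) < τ := by
        rw [Prod.dist_eq, Real.dist_eq u, sub_zero, abs_of_pos hu.1]
        exact max_lt hδ' (by linarith [hu.2])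
      have := hball hdist
      rwa [max_eq_left hu.1.le] at this
    rwa [hz] at this

lemma IsShotFamily.eventually_xi_pos (h : IsShotFamily M a m₁ m₂ Ξ Θ A)
    (hδ : δ ∈ Ioo 0 (π / 2)) {t₀ : ℝ} (hpos : ∀ t ∈ Ioc 0 t₀, 0 < Ξ δ t) :
    ∀ᶠ δ' in 𝓝 δ, ∀ t ∈ Ioc 0 t₀, 0 < Ξ δ' t := by
  have h2 := h.continuous_theta
  have h3 := h.continuous_alpha
  refine eventually_forall_Ioc_pos (F' := fun δ t => sin (2 * Θ δ t) * cos (A δ t))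
    h.continuous_xi ((continuous_sin.comp (h2.const_mul 2)).mul (continuous_cos.comp h3)) (fun δ t => (h.profile δ).xi t) h.xi_zero ?_ hpos
  simpa [h.theta_zero, h.alpha_zero] using sin_two_mul_pos hδ

lemma IsShotFamily.eventually_alpha_mem (h : IsShotFamily M a m₁ m₂ Ξ Θ A)
    (hQ : 0 < bal m₁ m₂ δ) {t₀ : ℝ} (hpos : ∀ t ∈ Ioc 0 t₀, A δ t ∈ Ioo 0 π) :
    ∀ᶠ δ' in 𝓝 δ, ∀ t ∈ Ioc 0 t₀, A δ' t ∈ Ioo 0 π := by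
  have h1 := h.continuous_xi
  have h2 := h.continuous_theta
  have h3 := h.continuous_alpha
  have ht : Continuous tanh :=
    continuous_iff_continuousAt.2 fun x => (hasDerivAt_tanh_real x).continuousAt
  have hb := continuous_bal (m₁ := m₁) (m₂ := m₂)
  have hlow := eventually_forall_Ioc_pos (F' := fun δ t =>
    M * sin (2 * Θ δ t) * tanh (a * Ξ δ t) * sin (A δ t) + bal m₁ m₂ (Θ δ t) * cos (A δ t))
    h.continuous_alpha
    ((((((continuous_sin.comp (h2.const_mul 2)).const_mul M).mul (ht.comp (h1.const_mul a))).mul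
      (continuous_sin.comp h3)).add ((hb.comp h2).mul (continuous_cos.comp h3)))) (fun δ t => (h.profile δ).alpha t) h.alpha_zero
    (by simpa [h.theta_zero, h.alpha_zero] using hQ) fun t ht => (hpos t ht).1
  have hup := eventually_forall_Icc_lt (F := fun δ t => π - A δ t) (u := 0) (v := t₀) (B := 0)
    (δ := δ) (continuous_const.sub h.continuous_alpha) le_rfl fun t ht => by
      rcases ht.1.eq_or_lt with rfl | h0
      · simp [h.alpha_zero, pi_pos]
      · exact sub_pos.2 (hpos t ⟨h0, ht.2⟩).2
  filter_upwards [hlow, hup] with δ' hl hu t ht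
  exact ⟨hl t ht, sub_pos.1 (hu t ⟨ht.1.le, ht.2⟩)⟩

/-! ### Initial heights close to the stationary one -/

/-- Close to the height `c` of the stationary solution there are initial heights for which the
solution does not return to the axis first. It follows the stationary solution far away from the
axis. It can turn back only after gaining a definite height above `c`, where the balance function
is negative, so `α` reaches `π` before `ξ` has returned to `0`. -/
theorem IsShotFamily.exists_not_returnsFirst (h : IsShotFamily M a m₁ m₂ Ξ Θ A) (hM : 0 < M)
    (ha : 0 < a) (hm₁ : 0 < m₁) (hm₂ : 0 < m₂) {c : ℝ} (hc : c ∈ Ioo 0 (π / 2))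
    (hcQ : bal m₁ m₂ c = 0) : ∃ δ ∈ Ioo 0 c, ¬ ReturnsFirst (Ξ δ) (A δ) := by
  have hpi := pi_pos
  have hanti := bal_strictAntiOn (m₁ := m₁) (m₂ := m₂) hm₁
  obtain ⟨hΞ, -, -⟩ := (h.profile c).eq_stationary (T := 0) hcQ (h.theta_zero c)
    (by rw [h.alpha_zero, sin_zero])
  simp only [h.xi_zero, h.alpha_zero, cos_zero, mul_one, sub_zero, zero_add] at hΞ
  have hs := sin_two_mul_pos hc
  have hwc := wt_pos (m₁ := m₁) (m₂ := m₂) hc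
  set x₁ := min (c + wt m₁ m₂ c / (2 * M)) ((c + π / 2) / 2) with hx₁
  have hx₁c : c < x₁ := lt_min (by linarith [div_pos hwc (by positivity : 0 < 2 * M)])
    (by linarith [hc.2])
  have hx₁π : x₁ < π / 2 := (min_le_right _ _).trans_lt (by linarith [hc.2])
  set k := -bal m₁ m₂ x₁ with hk
  have hk0 : 0 < k := by
    have := hanti ⟨hc.1.le, hc.2.le⟩ ⟨(hc.1.trans hx₁c).le, hx₁π.le⟩ hx₁c
    linarith
  set N := (π / k + 1) / sin (2 * c) with hN
  have hN0 : 0 < N := by positivity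
  have hΞN : Ξ c N = π / k + 1 := by
    rw [hΞ, hN]
    simp only
    field_simp
  have ev1 := h.eventually_xi_pos (t₀ := N) hc fun t ht => by
    rw [hΞ]; exact mul_pos hs ht.1
  have ev2 : ∀ᶠ δ in 𝓝 c, π / k < Ξ δ N :=
    ((continuous_slice h.continuous_xi hN0.le).tendsto c).eventually_const_lt
      (by rw [hΞN]; linarith)
  have ev3 : ∀ᶠ δ in 𝓝 c, x₁ < δ + wt m₁ m₂ δ / M := by
    have hcont : Continuous fun δ => δ + wt m₁ m₂ δ / M := by
      have := continuous_wt (m₁ := m₁) (m₂ := m₂)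
      fun_prop
    refine (hcont.tendsto c).eventually_const_lt ((min_le_left _ _).trans_lt ?_)
    have : wt m₁ m₂ c / (2 * M) = wt m₁ m₂ c / M / 2 := by field_simp
    have := div_pos hwc hM
    linarith
  obtain ⟨δ, ⟨⟨h1, h2⟩, h3⟩, hδ⟩ := ((((ev1.and ev2).and ev3).filter_mono
    nhdsWithin_le_nhds).and (Ioo_mem_nhdsLT hc.1)).exists
  refine ⟨δ, hδ, fun hr => ?_⟩
  have hδI : δ ∈ Ioo 0 (π / 2) := ⟨hδ.1, hδ.2.trans hc.2⟩
  have hQδ : 0 < bal m₁ m₂ δ := hcQ ▸ hanti ⟨hδI.1.le, hδI.2.le⟩ ⟨hc.1.le, hc.2.le⟩ hδ.2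
  have hϑ := (h.shot δ).theta_mem hδI
  obtain ⟨T, hT, hξT, hαT, hgood⟩ := (h.shot δ).exists_first_return hδI hQδ hr
  have hNT : N < T := by
    by_contra! hle
    exact absurd hξT (h1 T ⟨hT, hle⟩).ne'
  have hg : ∀ t ∈ Icc N T, 0 ≤ Ξ δ t ∧ A δ t ∈ Icc 0 π := by
    intro t ht
    rcases ht.2.eq_or_lt with rfl | hlt
    · exact ⟨hξT.ge, hαT⟩
    · have := hgood t ⟨hN0.trans_le ht.1, hlt⟩
      exact ⟨this.1.le, Ioo_subset_Icc_self this.2⟩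
  have := (h.profile δ).xi_drop_le hM ha (hϑ 0) hNT.le hk0 zero_le_one (fun t ht => (hg t ht).1)
    (fun t ht => (hg t ht).2) fun t ht hct => by
      refine ⟨?_, sin_le_one _⟩
      have hP := (h.profile δ).le_momentum hM.le hm₁ hm₂ (hϑ 0) (u := 0) (v := t) (B := 1)
        (hN0.le.trans ht.1) zero_le_one (fun u _ => (tanh_lt_one _).le) fun u hu =>
          have hαu := (hgood u ⟨hu.1, hu.2.trans_le ht.2⟩).2
          (sin_pos_of_pos_of_lt_pi hαu.1 hαu.2).le
      rw [h.theta_zero, h.alpha_zero, cos_zero, mul_one, mul_one] at hP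
      have hP0 := mul_nonpos_of_nonneg_of_nonpos
        (wt_pos (m₁ := m₁) (m₂ := m₂) (hϑ t)).le hct
      have hx : x₁ ≤ Θ δ t := by
        have : wt m₁ m₂ δ / M ≤ Θ δ t - δ := by rw [div_le_iff₀ hM]; linarith
        linarith
      have := hanti.antitoneOn ⟨(hc.1.trans hx₁c).le, hx₁π.le⟩ ⟨(hϑ t).1.le, (hϑ t).2.le⟩ hx
      linarith
  have e : 1 / k * π = π / k := by ring
  linarith

/-! ### The critical initial height -/

/-- A limit of initial heights from below for which the solution returns to the axis first has an
event: otherwise it would run into the boundary `ϑ = π/2` at a positive distance from the axis,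
and close to that boundary `ξ` is nearly constant along all nearby solutions. -/
theorem IsShotFamily.not_forever (h : IsShotFamily M a m₁ m₂ Ξ Θ A) (hM : 0 < M) (ha : 0 < a)
    (hm₁ : 0 < m₁) (hm₂ : 0 < m₂) {c : ℝ} (hc : c ∈ Ioo 0 (π / 2)) (hcQ : bal m₁ m₂ c = 0)
    (hδ : δ ∈ Ioo 0 c) (hbelow : ∀ δ' ∈ Ioo 0 δ, ReturnsFirst (Ξ δ') (A δ'))
    (hf : ∀ t > 0, 0 < Ξ δ t ∧ A δ t ∈ Ioo 0 π) : False := by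
  have hpi := pi_pos
  have hδI : δ ∈ Ioo 0 (π / 2) := ⟨hδ.1, hδ.2.trans hc.2⟩
  have hanti := bal_strictAntiOn (m₁ := m₁) (m₂ := m₂) hm₁
  have hX := (hf 1 one_pos).1
  have hmono : ∀ t ≥ 1, Ξ δ 1 ≤ Ξ δ t := fun t ht =>
    le_of_hasDerivAt_nonneg ht (fun u _ => (h.profile δ).xi u) fun u hu =>
      mul_nonneg (sin_two_mul_pos ((h.shot δ).theta_mem hδI u)).le
        ((h.shot δ).cos_nonneg_of_forever hM ha hm₁ hm₂ hδI hf (one_pos.trans hu.1))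
  have hm₂' : (0 : ℝ) < m₂ := by exact_mod_cast hm₂
  set s₀ := m₂ * Ξ δ 1 / (2 * π) with hs₀
  have hs₀0 : 0 < s₀ := by positivity
  obtain ⟨x₂, hx₂, hx₂le⟩ : ∃ x₂ < π / 2, ∀ y ∈ Ioo x₂ (π / 2),
      bal m₁ m₂ y < -m₂ ∧ sin (2 * y) < s₀ := by
    have h1 : bal m₁ m₂ (π / 2) < -m₂ := by simp [bal]; linarith
    have hcont : Continuous fun y => sin (2 * y) := by fun_prop
    have h2 : sin (2 * (π / 2)) < s₀ := by rwa [mul_div_cancel₀ _ two_ne_zero, sin_pi]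
    have hev := ((continuous_bal.tendsto (π / 2)).eventually_lt_const h1).and
      ((hcont.tendsto (π / 2)).eventually_lt_const h2)
    obtain ⟨x₂, hx₂, hsub⟩ := mem_nhdsLT_iff_exists_Ioo_subset.1 (hev.filter_mono
      (nhdsWithin_le_nhds (s := Iio (π / 2))))
    exact ⟨x₂, hx₂, fun y hy => hsub hy⟩
  obtain ⟨t₀, ht₀x, ht₀⟩ := ((((h.shot δ).tendsto_theta_of_forever hM ha hm₁ hm₂ hδI
    hf).eventually_const_lt hx₂).and (eventually_ge_atTop 1)).exists
  have ht₀0 : 0 < t₀ := one_pos.trans_le ht₀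
  have ev1 := h.eventually_xi_pos (t₀ := t₀) hδI fun t ht => (hf t ht.1).1
  have ev2 : ∀ᶠ δ' in 𝓝 δ, Ξ δ 1 / 2 < Ξ δ' t₀ :=
    ((continuous_slice h.continuous_xi ht₀0.le).tendsto δ).eventually_const_lt
      (by linarith [hmono t₀ ht₀])
  have ev3 : ∀ᶠ δ' in 𝓝 δ, x₂ < Θ δ' t₀ :=
    ((continuous_slice h.continuous_theta ht₀0.le).tendsto δ).eventually_const_lt ht₀x
  obtain ⟨δ', ⟨⟨h1, h2⟩, h3⟩, hδ'⟩ := ((((ev1.and ev2).and ev3).filter_mono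
    nhdsWithin_le_nhds).and (Ioo_mem_nhdsLT hδ.1)).exists
  have hδ'I : δ' ∈ Ioo 0 (π / 2) := ⟨hδ'.1, hδ'.2.trans hδI.2⟩
  have hQδ : 0 < bal m₁ m₂ δ' :=
    hcQ ▸ hanti ⟨hδ'I.1.le, hδ'I.2.le⟩ ⟨hc.1.le, hc.2.le⟩ (hδ'.2.trans hδ.2)
  have hϑ := (h.shot δ').theta_mem hδ'I
  obtain ⟨T, hT, hξT, hαT, hgood⟩ := (h.shot δ').exists_first_return hδ'I hQδ (hbelow δ' hδ')
  have htT : t₀ < T := by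
    by_contra! hle
    exact absurd hξT (h1 T ⟨hT, hle⟩).ne'
  have hg : ∀ t ∈ Icc t₀ T, 0 ≤ Ξ δ' t ∧ A δ' t ∈ Icc 0 π := by
    intro t ht
    rcases ht.2.eq_or_lt with rfl | hlt
    · exact ⟨hξT.ge, hαT⟩
    · have := hgood t ⟨ht₀0.trans_le ht.1, hlt⟩
      exact ⟨this.1.le, Ioo_subset_Icc_self this.2⟩
  have := (h.profile δ').xi_drop_le hM ha (hϑ 0) htT.le hm₂' hs₀0.le (fun t ht => (hg t ht).1)
    (fun t ht => (hg t ht).2) fun t ht _ => by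
      have hle : Θ δ' t₀ ≤ Θ δ' t := le_of_hasDerivAt_nonneg ht.1
        (fun u _ => (h.profile δ').theta u) fun u hu => by
          have := (hg u ⟨hu.1.le, hu.2.le.trans ht.2⟩).2
          exact mul_nonneg (sin_two_mul_pos (hϑ u)).le
            (sin_nonneg_of_nonneg_of_le_pi this.1 this.2)
      have := hx₂le _ ⟨h3.trans_le hle, (hϑ t).2⟩
      exact ⟨this.1.le, this.2.le⟩
  have e : s₀ / m₂ * π = Ξ δ 1 / 2 := by rw [hs₀]; field_simp
  linarith

/-- At a critical height, which is a limit from below of heights with a return to the axis but is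
not in the interior of the set of these heights, the return to the axis and the next horizontal
point coincide. Every other event is transversal and would persist for nearby heights. -/
theorem IsShotFamily.exists_simultaneous (h : IsShotFamily M a m₁ m₂ Ξ Θ A) (hM : 0 < M)
    (ha : 0 < a) (hm₁ : 0 < m₁) (hm₂ : 0 < m₂) {c : ℝ} (hc : c ∈ Ioo 0 (π / 2))
    (hcQ : bal m₁ m₂ c = 0) (hδ : δ ∈ Ioo 0 c)
    (hbelow : ∀ δ' ∈ Ioo 0 δ, ReturnsFirst (Ξ δ') (A δ'))
    (hcrit : ¬ ∀ᶠ δ' in 𝓝 δ, ReturnsFirst (Ξ δ') (A δ')) :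
    ∃ T > 0, Ξ δ T = 0 ∧ A δ T = π ∧ ∀ t ∈ Ioo 0 T, 0 < Ξ δ t ∧ A δ t ∈ Ioo 0 π := by
  have hpi := pi_pos
  have hδI : δ ∈ Ioo 0 (π / 2) := ⟨hδ.1, hδ.2.trans hc.2⟩
  have hanti := bal_strictAntiOn (m₁ := m₁) (m₂ := m₂) hm₁
  have hQδ : 0 < bal m₁ m₂ δ := hcQ ▸ hanti ⟨hδI.1.le, hδI.2.le⟩ ⟨hc.1.le, hc.2.le⟩ hδ.2
  have hϑ := (h.shot δ).theta_mem hδI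
  have hpr := h.profile δ
  rcases (h.shot δ).forever_or_first_event hδI hQδ with hf | ⟨T, hT, hgood, hξT, hαT, hev⟩
  · exact (h.not_forever hM ha hm₁ hm₂ hc hcQ hδ hbelow hf).elim
  have hsT := sin_two_mul_pos (hϑ T)
  by_cases hhor : A δ T = 0 ∨ A δ T = π
  · -- a horizontal point away from the axis persists, and prevents a return to the axis
    have hsin : sin (A δ T) = 0 := by rcases hhor with e | e <;> simp [e]
    have hcos : cos (A δ T) ^ 2 = 1 := by rcases hhor with e | e <;> simp [e]
    have hQT : bal m₁ m₂ (Θ δ T) < 0 := by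
      refine lt_of_le_of_ne (hpr.bal_nonpos_of_horizontal hT (fun t ht => (hgood t ht).2) hhor)
        fun hz => ?_
      obtain ⟨-, hst, -⟩ := hpr.eq_stationary hz rfl hsin
      have := congrFun hst 0
      rw [h.theta_zero] at this
      rw [← this] at hz
      exact hQδ.ne' hz
    rcases hξT.eq_or_lt with hz | hξT
    · rcases hhor with e | e
      · have := hasDerivAt_nonpos_of_pos_left hT (hpr.xi T) hz.symm fun t ht => (hgood t ht).1
        rw [e, cos_zero, mul_one] at this
        linarith
      · exact ⟨T, hT, hz.symm, e, hgood⟩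
    exfalso
    have hr : ∀ᶠ t in 𝓝[>] T, 0 < -sin (A δ t) :=
      eventually_pos_right (hpr.alpha T).sin.neg (by simp [hsin]) (by
        rw [hsin]
        nlinarith)
    have hξr : ∀ᶠ t in 𝓝 T, 0 < Ξ δ t :=
      (hpr.continuous_xi.tendsto T).eventually_const_lt hξT
    obtain ⟨ε, hε, hball⟩ := Metric.eventually_nhds_iff.1 hξr
    obtain ⟨t, ht, htI⟩ := (hr.and (Ioo_mem_nhdsGT (show T < T + ε by linarith))).exists
    have ht0 : 0 < t := hT.trans htI.1
    have ev1 := h.eventually_xi_pos (t₀ := t) hδI fun u hu => by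
      rcases lt_or_ge u T with hlt | hge
      · exact (hgood u ⟨hu.1, hlt⟩).1
      · refine hball ?_
        rw [Real.dist_eq, abs_of_nonneg (sub_nonneg.2 hge)]
        linarith [hu.2, htI.2]
    have ev2 : ∀ᶠ δ' in 𝓝 δ, sin (A δ' t) < 0 :=
      ((continuous_sin.comp (continuous_slice h.continuous_alpha ht0.le)).tendsto
        δ).eventually_lt_const (by simpa using ht)
    obtain ⟨δ', ⟨h1, h2⟩, hδ'⟩ := (((ev1.and ev2).filter_mono
      nhdsWithin_le_nhds).and (Ioo_mem_nhdsLT hδ.1)).exists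
    have hδ'I : δ' ∈ Ioo 0 (π / 2) := ⟨hδ'.1, hδ'.2.trans hδI.2⟩
    have hQδ' : 0 < bal m₁ m₂ δ' :=
      hcQ ▸ hanti ⟨hδ'I.1.le, hδ'I.2.le⟩ ⟨hc.1.le, hc.2.le⟩ (hδ'.2.trans hδ.2)
    obtain ⟨T', hT', hξT', -, hgood'⟩ :=
      (h.shot δ').exists_first_return hδ'I hQδ' (hbelow δ' hδ')
    have htT : t < T' := by
      by_contra! hle
      exact absurd hξT' (h1 T' ⟨hT', hle⟩).ne'
    have := (hgood' t ⟨ht0, htT⟩).2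
    linarith [sin_pos_of_pos_of_lt_pi this.1 this.2]
  · -- a transversal return to the axis persists
    exfalso
    apply hcrit
    have hξT0 : Ξ δ T = 0 := hev.resolve_right hhor
    push Not at hhor
    have hαI : A δ T ∈ Ioo 0 π :=
      ⟨lt_of_le_of_ne hαT.1 hhor.1.symm, lt_of_le_of_ne hαT.2 hhor.2⟩
    have hd := hasDerivAt_nonpos_of_pos_left hT (hpr.xi T) hξT0 fun t ht => (hgood t ht).1
    have hcos : cos (A δ T) ≠ 0 := by
      intro hc0
      have hα : A δ T = π / 2 := by
        rw [← arccos_cos hαT.1 hαT.2, hc0, arccos_zero]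
      have := hpr.alpha_eq_of_axis hξT0 hα 0
      rw [h.alpha_zero] at this
      linarith
    have hd' : sin (2 * Θ δ T) * cos (A δ T) < 0 := lt_of_le_of_ne hd (mul_ne_zero hsT.ne' hcos)
    have hr : ∀ᶠ t in 𝓝[>] T, 0 < -Ξ δ t :=
      eventually_pos_right (hpr.xi T).neg (by simp [hξT0]) (by linarith)
    have hαr : ∀ᶠ t in 𝓝 T, A δ t ∈ Ioo 0 π :=
      (hpr.continuous_alpha.tendsto T).eventually (Ioo_mem_nhds hαI.1 hαI.2)
    obtain ⟨ε, hε, hball⟩ := Metric.eventually_nhds_iff.1 hαr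
    obtain ⟨t, ht, htI⟩ := (hr.and (Ioo_mem_nhdsGT (show T < T + ε by linarith))).exists
    have ht0 : 0 < t := hT.trans htI.1
    have ev1 := h.eventually_alpha_mem (t₀ := t) hQδ fun u hu => by
      rcases lt_or_ge u T with hlt | hge
      · exact (hgood u ⟨hu.1, hlt⟩).2
      · refine hball ?_
        rw [Real.dist_eq, abs_of_nonneg (sub_nonneg.2 hge)]
        linarith [hu.2, htI.2]
    have ev2 : ∀ᶠ δ' in 𝓝 δ, Ξ δ' t < 0 :=
      ((continuous_slice h.continuous_xi ht0.le).tendsto δ).eventually_lt_const (by linarith)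
    filter_upwards [ev1, ev2, Ioo_mem_nhds hδI.1 hδI.2] with δ' h1 h2 hδ'
    obtain ⟨u, hu, hu'⟩ := (((h.shot δ').eventually_xi_pos hδ').and (Ioo_mem_nhdsGT ht0)).exists
    obtain ⟨T', hT', hξT'⟩ := intermediate_value_Ioo' hu'.2.le
      (h.profile δ').continuous_xi.continuousOn (show (0 : ℝ) ∈ Ioo _ _ from ⟨h2, hu⟩)
    exact ⟨T', hu'.1.trans hT'.1, hξT', fun v hv =>
      have := h1 v ⟨hv.1, (hv.2.trans hT'.2).le⟩
      (sin_pos_of_pos_of_lt_pi this.1 this.2).ne'⟩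

variable {T : ℝ}

/-! ### Closing up the critical profile curve -/

/-- A solution starting on the axis with `α = 0` is symmetric under `t ↦ -t` combined with the
reflection in the axis. -/
lemma IsProfileShot.symm_zero (h : IsProfileShot M a m₁ m₂ δ ξ ϑ α) (t : ℝ) :
    ξ (-t) = -ξ t ∧ ϑ (-t) = ϑ t ∧ α (-t) = -α t := by
  obtain ⟨h1, h2, h3⟩ := (h.profile.reverse 0 (κ := 0) (by simp) (by simp)).unique h.profile
    (T := 0) (by simp [h.xi_zero]) (by simp) (by simp [h.alpha_zero])
  have e1 := congrFun h1 t
  have e2 := congrFun h2 t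
  have e3 := congrFun h3 t
  simp only [zero_sub] at e1 e2 e3
  exact ⟨by linarith, e2, by linarith⟩

/-- A solution that crosses the axis at time `T` with `α = π` is symmetric under `t ↦ 2T - t`
combined with the reflection in the axis. -/
lemma IsProfile.symm_of_alpha_eq_pi (h : IsProfile M a m₁ m₂ ξ ϑ α) (hξ : ξ T = 0) (hα : α T = π)
    (t : ℝ) : ξ (2 * T - t) = -ξ t ∧ ϑ (2 * T - t) = ϑ t ∧ α (2 * T - t) = 2 * π - α t := by
  have e : 2 * T - T = T := by ring
  obtain ⟨h1, h2, h3⟩ := (h.reverse (2 * T) (κ := 2 * π) sin_two_pi_sub cos_two_pi_sub).unique h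
    (T := T) (by simp [e, hξ]) (by simp [e]) (by simp only [e, hα]; ring)
  have e1 := congrFun h1 t
  have e2 := congrFun h2 t
  have e3 := congrFun h3 t
  exact ⟨by linarith, e2, by linarith⟩

lemma IsProfileShot.periodic (h : IsProfileShot M a m₁ m₂ δ ξ ϑ α) (hξ : ξ T = 0) (hα : α T = π)
    (t : ℝ) : ξ (t + 2 * T) = ξ t ∧ ϑ (t + 2 * T) = ϑ t ∧ α (t + 2 * T) = α t + 2 * π := by
  obtain ⟨h1, h2, h3⟩ := h.profile.symm_of_alpha_eq_pi hξ hα (-t)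
  obtain ⟨k1, k2, k3⟩ := h.symm_zero t
  rw [show t + 2 * T = 2 * T - -t by ring]
  exact ⟨by rw [h1, k1, neg_neg], by rw [h2, k2], by rw [h3, k3]; ring⟩

lemma IsProfileShot.xi_eq_zero_iff (h : IsProfileShot M a m₁ m₂ δ ξ ϑ α) (hT : 0 < T)
    (hξ : ξ T = 0) (hα : α T = π) (hgood : ∀ t ∈ Ioo 0 T, 0 < ξ t ∧ α t ∈ Ioo 0 π) (t : ℝ) :
    ξ t = 0 ↔ sin (α t) = 0 := by
  have hper : Function.Periodic (fun t => (ξ t, sin (α t))) (2 * T) := fun t => by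
    obtain ⟨h1, -, h3⟩ := h.periodic hξ hα t
    simp [h1, h3, sin_add_two_pi]
  have hne : ∀ t ∈ Ioo 0 T, ξ t ≠ 0 ∧ sin (α t) ≠ 0 := fun t ht =>
    ⟨(hgood t ht).1.ne', (sin_pos_of_pos_of_lt_pi (hgood t ht).2.1 (hgood t ht).2.2).ne'⟩
  obtain ⟨y, hy, hty⟩ := hper.exists_mem_Ico (by positivity) t (-T)
  simp only [Prod.mk.injEq] at hty
  rw [hty.1, hty.2]
  obtain ⟨k1, -, k3⟩ := h.symm_zero (-y)
  rw [neg_neg] at k1 k3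
  rcases lt_trichotomy y 0 with hy0 | rfl | hy0
  · rcases hy.1.eq_or_lt with rfl | hyT
    · rw [k1, k3]; simp [hξ, hα]
    · have := hne (-y) ⟨by linarith, by linarith⟩
      rw [k1, k3]; simp [this.1, this.2]
  · simp [h.xi_zero, h.alpha_zero]
  · have := hne y ⟨hy0, by linarith [hy.2]⟩
    simp [this.1, this.2]

/-- On `[0, T]` the curve lies in `ξ ≥ 0` and rises; on `(T, 2T)` it is the mirror image in
`ξ < 0`. -/
lemma IsProfileShot.injOn (h : IsProfileShot M a m₁ m₂ δ ξ ϑ α) (hδ : δ ∈ Ioo 0 (π / 2))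
    (hT : 0 < T) (hξ : ξ T = 0) (hα : α T = π)
    (hgood : ∀ t ∈ Ioo 0 T, 0 < ξ t ∧ α t ∈ Ioo 0 π) :
    InjOn (fun t => (ξ t, ϑ t)) (Ico 0 (2 * T)) := by
  have hmono : StrictMonoOn ϑ (Icc 0 T) := fun u hu v hv huv =>
    lt_of_hasDerivAt_pos huv (fun t _ => h.profile.theta t) fun t ht => by
      have := (hgood t ⟨hu.1.trans_lt ht.1, ht.2.trans_le hv.2⟩).2
      exact mul_pos (sin_two_mul_pos (h.theta_mem hδ t)) (sin_pos_of_pos_of_lt_pi this.1 this.2)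
  have hnonneg : ∀ t ∈ Icc 0 T, 0 ≤ ξ t := by
    intro t ht
    rcases ht.1.eq_or_lt with rfl | h0
    · exact h.xi_zero.ge
    rcases ht.2.eq_or_lt with rfl | h1
    · exact hξ.ge
    · exact (hgood t ⟨h0, h1⟩).1.le
  have hsymm := h.profile.symm_of_alpha_eq_pi hξ hα
  have hneg : ∀ t ∈ Ioo T (2 * T), ξ t < 0 := by
    intro t ht
    have := (hgood (2 * T - t) ⟨by linarith [ht.2], by linarith [ht.1]⟩).1
    rw [(hsymm t).1] at this
    linarith
  intro u hu v hv huv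
  simp only [Prod.mk.injEq] at huv
  rcases le_or_gt u T with huT | huT <;> rcases le_or_gt v T with hvT | hvT
  · exact hmono.injOn ⟨hu.1, huT⟩ ⟨hv.1, hvT⟩ huv.2
  · linarith [hnonneg u ⟨hu.1, huT⟩, hneg v ⟨hvT, hv.2⟩]
  · linarith [hnonneg v ⟨hv.1, hvT⟩, hneg u ⟨huT, hu.2⟩]
  · have := hmono.injOn (show 2 * T - u ∈ Icc 0 T from ⟨by linarith [hu.2], by linarith⟩)
      (show 2 * T - v ∈ Icc 0 T from ⟨by linarith [hv.2], by linarith⟩)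
      (by rw [(hsymm u).2.1, (hsymm v).2.1, huv.2])
    linarith

theorem IsProfileShot.isSmoothSimpleClosedCurve (h : IsProfileShot M a m₁ m₂ δ ξ ϑ α)
    (hδ : δ ∈ Ioo 0 (π / 2)) (hT : 0 < T) (hξ : ξ T = 0) (hα : α T = π)
    (hgood : ∀ t ∈ Ioo 0 T, 0 < ξ t ∧ α t ∈ Ioo 0 π) :
    IsSmoothSimpleClosedCurve (fun t => (ξ t, ϑ t)) (2 * T) where
  contDiff := h.profile.contDiff.fst.prodMk h.profile.contDiff.snd.fst
  regular t := by
    rw [((h.profile.xi t).prodMk (h.profile.theta t)).deriv, Ne, Prod.mk_eq_zero, not_and]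
    have hs := (sin_two_mul_pos (h.theta_mem hδ t)).ne'
    intro h1 h2
    have h1' := (mul_eq_zero.1 h1).resolve_left hs
    have h2' := (mul_eq_zero.1 h2).resolve_left hs
    have := sin_sq_add_cos_sq (α t)
    rw [h1', h2'] at this
    norm_num at this
  period_pos := by positivity
  periodic t := by
    obtain ⟨h1, h2, -⟩ := h.periodic hξ hα t
    simp [h1, h2]
  injOn := h.injOn hδ hT hξ hα hgood

/-! ### The critical height of the shooting problem -/

section Critical

variable {g n : ℕ}

lemma isShot_zero_iff : IsShot g n m₁ m₂ 0 δ ξ ϑ α ↔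
    IsProfileShot (2 * n / g) (2 / g) m₁ m₂ δ ξ ϑ α := by
  constructor
  · rintro ⟨⟨h1, h2, h3⟩, hξ, hϑ, hα⟩
    exact ⟨⟨h1, h2, fun t => by simpa [bal] using h3 t⟩, hξ, hϑ, hα⟩
  · rintro ⟨⟨h1, h2, h3⟩, hξ, hϑ, hα⟩
    exact ⟨⟨h1, h2, fun t => by simpa [bal] using h3 t⟩, hξ, hϑ, hα⟩

lemma IsProfileShot.deriv_theta_eq_zero_iff (h : IsProfileShot M a m₁ m₂ δ ξ ϑ α)
    (hδ : δ ∈ Ioo 0 (π / 2)) (t : ℝ) : deriv ϑ t = 0 ↔ sin (α t) = 0 := by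
  rw [(h.profile.theta t).deriv, mul_eq_zero,
    or_iff_right (sin_two_mul_pos (h.theta_mem hδ t)).ne']

lemma isType1_zero_iff (hF : IsShotFamily (2 * n / g) (2 / g) m₁ m₂ Ξ Θ A) :
    IsType1 g n m₁ m₂ 0 δ ↔ δ ∈ Ioo 0 (π / 2) ∧ ReturnsFirst (Ξ δ) (A δ) := by
  constructor
  · rintro ⟨hδ, ξ, ϑ, α, hs, T, hT, hξ, hne⟩
    have h := isShot_zero_iff.1 hs
    have hF' := hF.shot δ
    obtain ⟨rfl, rfl, rfl⟩ := h.profile.unique hF'.profile (T := 0)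
      (h.xi_zero.trans hF'.xi_zero.symm) (h.theta_zero.trans hF'.theta_zero.symm)
      (h.alpha_zero.trans hF'.alpha_zero.symm)
    exact ⟨hδ, T, hT, hξ, fun t ht h0 => hne t ht ((h.deriv_theta_eq_zero_iff hδ t).2 h0)⟩
  · rintro ⟨hδ, T, hT, hξ, hne⟩
    exact ⟨hδ, _, _, _, isShot_zero_iff.2 (hF.shot δ), T, hT, hξ, fun t ht h0 =>
      hne t ht (((hF.shot δ).deriv_theta_eq_zero_iff hδ t).1 h0)⟩

/-- The critical height lies strictly between `0` and the height of the stationary solution; it is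
a limit from below of heights of type 1, but not in the interior of the set of these heights. -/
theorem criticalHeight_spec (hF : IsShotFamily (2 * n / g) (2 / g) m₁ m₂ Ξ Θ A)
    (hM : (0 : ℝ) < 2 * n / g) (ha : (0 : ℝ) < 2 / g) (hm₁ : 0 < m₁) (hm₂ : 0 < m₂) {c : ℝ}
    (hc : c ∈ Ioo 0 (π / 2)) (hcQ : bal m₁ m₂ c = 0) :
    criticalHeight g n m₁ m₂ 0 ∈ Ioo 0 c ∧
      (∀ δ ∈ Ioo 0 (criticalHeight g n m₁ m₂ 0), ReturnsFirst (Ξ δ) (A δ)) ∧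
      ¬ ∀ᶠ δ in 𝓝 (criticalHeight g n m₁ m₂ 0), ReturnsFirst (Ξ δ) (A δ) := by
  set S := {δ | δ ∈ Ioo 0 (π / 2) ∧ ∀ δ₀ ∈ Ioo 0 δ, IsType1 g n m₁ m₂ 0 δ₀} with hS
  set d := criticalHeight g n m₁ m₂ 0 with hd
  have hdS : d = sSup S := rfl
  obtain ⟨δ₂, hδ₂, hδ₂n⟩ := hF.exists_not_returnsFirst hM ha hm₁ hm₂ hc hcQ
  have hupper : ∀ δ ∈ S, δ ≤ δ₂ := by
    intro δ hδ
    by_contra! hlt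
    exact hδ₂n ((isType1_zero_iff hF).1 (hδ.2 δ₂ ⟨hδ₂.1, hlt⟩)).2
  have hbdd : BddAbove S := ⟨δ₂, hupper⟩
  obtain ⟨δ₀, hδ₀, hsmall⟩ := mem_nhdsGT_iff_exists_Ioo_subset.1
    (eventually_returnsFirst hM ha hm₁ hm₂)
  have hpi := pi_pos
  have hδ₀' : (0 : ℝ) < δ₀ := hδ₀
  have hmem : min δ₀ (π / 4) ∈ S := by
    refine ⟨⟨by positivity, (min_le_right _ _).trans_lt (by linarith)⟩, fun δ hδ => ?_⟩
    refine (isType1_zero_iff hF).2 ⟨⟨hδ.1, ?_⟩, ?_⟩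
    · linarith [hδ.2.trans_le (min_le_right _ _)]
    · exact hsmall ⟨hδ.1, hδ.2.trans_le (min_le_left _ _)⟩ _ _ _ (hF.shot δ)
  have hd0 : 0 < d := hmem.1.1.trans_le (le_csSup hbdd hmem)
  have hdc : d < c := (csSup_le ⟨_, hmem⟩ hupper).trans_lt hδ₂.2
  have hbelow : ∀ δ ∈ Ioo 0 d, ReturnsFirst (Ξ δ) (A δ) := by
    intro δ hδ
    obtain ⟨s, hs, hlt⟩ := exists_lt_of_lt_csSup ⟨_, hmem⟩ hδ.2
    exact ((isType1_zero_iff hF).1 (hs.2 δ ⟨hδ.1, hlt⟩)).2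
  refine ⟨⟨hd0, hdc⟩, hbelow, fun hev => ?_⟩
  obtain ⟨ε, hε, hball⟩ := Metric.eventually_nhds_iff.1 hev
  have hd2 : d < π / 2 := hdc.trans hc.2
  set e := d + min (ε / 2) ((π / 2 - d) / 2) with he
  have hde : d < e := by
    have : 0 < min (ε / 2) ((π / 2 - d) / 2) := lt_min (by positivity) (by linarith)
    linarith
  have he1 : e ≤ d + ε / 2 := (add_le_add_iff_left d).2 (min_le_left _ _)
  have he2 : e ≤ d + (π / 2 - d) / 2 := (add_le_add_iff_left d).2 (min_le_right _ _)
  have heS : e ∈ S := by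
    refine ⟨⟨hd0.trans hde, by linarith⟩, fun δ hδ => ?_⟩
    refine (isType1_zero_iff hF).2 ⟨⟨hδ.1, by linarith [hδ.2]⟩, ?_⟩
    rcases lt_or_ge δ d with hlt | hge
    · exact hbelow δ ⟨hδ.1, hlt⟩
    · refine hball ?_
      rw [Real.dist_eq, abs_of_nonneg (sub_nonneg.2 hge)]
      linarith [hδ.2]
  exact absurd (le_csSup hbdd heS) (not_le.2 hde)

end Critical

end Profile

theorem proposition3p4 (g n m₁ m₂ : ℕ) (hg : g ∈ ({1, 2, 3, 4, 6} : Set ℕ))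
    (hm₁ : 0 < m₁) (hm₂ : 0 < m₂) (hodd : Odd g → m₁ = m₂)
    (hn : 2 * n = g * (m₁ + m₂) + 2) :
    IsType1 g n m₁ m₂ 0 (criticalHeight g n m₁ m₂ 0) ∧
    IsType2 g n m₁ m₂ 0 (criticalHeight g n m₁ m₂ 0) ∧
    ∀ ξ ϑ α : ℝ → ℝ, IsShot g n m₁ m₂ 0 (criticalHeight g n m₁ m₂ 0) ξ ϑ α →
      (∀ t, ϑ t ∈ Ioo 0 (π / 2)) ∧
      (∀ t, ξ t = 0 ↔ deriv ϑ t = 0) ∧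
      ∃ T > 0, ξ T = 0 ∧ deriv ϑ T = 0 ∧
        (∀ t ∈ Ioo 0 T, ξ t ≠ 0 ∧ deriv ϑ t ≠ 0) ∧
        IsSmoothSimpleClosedCurve (fun t => (ξ t, ϑ t)) (2 * T) := by
  have hg0 : 0 < g := by
    rcases hg with rfl | rfl | rfl | rfl | rfl <;> norm_num
  have hn0 : 0 < n := by omega
  have hM : (0 : ℝ) < 2 * n / g := by positivity
  have ha : (0 : ℝ) < 2 / g := by positivity
  obtain ⟨c, hc, hcQ⟩ := exists_bal_eq_zero hm₁ hm₂
  obtain ⟨Ξ, Θ, A, hF⟩ := exists_isShotFamily (2 * n / g) (2 / g) m₁ m₂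
  obtain ⟨hd, hbelow, hcrit⟩ := criticalHeight_spec hF hM ha hm₁ hm₂ hc hcQ
  obtain ⟨T, hT, hξT, hαT, hgood⟩ := hF.exists_simultaneous hM ha hm₁ hm₂ hc hcQ hd hbelow hcrit
  set d := criticalHeight g n m₁ m₂ 0
  have hdI : d ∈ Ioo 0 (π / 2) := ⟨hd.1, hd.2.trans hc.2⟩
  have hs := hF.shot d
  have hsin : ∀ t ∈ Ioo 0 T, sin (A d t) ≠ 0 := fun t ht =>
    (sin_pos_of_pos_of_lt_pi (hgood t ht).2.1 (hgood t ht).2.2).ne'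
  have hderiv := hs.deriv_theta_eq_zero_iff hdI
  have hT0 : deriv (Θ d) T = 0 := (hderiv T).2 (by rw [hαT, sin_pi])
  refine ⟨(isType1_zero_iff hF).2 ⟨hdI, T, hT, hξT, hsin⟩,
    ⟨hdI, _, _, _, isShot_zero_iff.2 hs, T, hT, hT0, fun t ht => (hgood t ht).1.ne'⟩, ?_⟩
  intro ξ ϑ α hshot
  have h := isShot_zero_iff.1 hshot
  obtain ⟨rfl, rfl, rfl⟩ := h.profile.unique hs.profile (T := 0)
    (h.xi_zero.trans hs.xi_zero.symm) (h.theta_zero.trans hs.theta_zero.symm)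
    (h.alpha_zero.trans hs.alpha_zero.symm)
  exact ⟨hs.theta_mem hdI,
    fun t => (hs.xi_eq_zero_iff hT hξT hαT hgood t).trans (hderiv t).symm,
    T, hT, hξT, hT0, fun t ht => ⟨(hgood t ht).1.ne', fun h0 => hsin t ht ((hderiv t).1 h0)⟩,
    hs.isSmoothSimpleClosedCurve hdI hT hξT hαT hgood⟩
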